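/- **Model.** Let $x_{fn}\in\mathbb C^M$ ($f=1,\dots,F$, $n=1,\dots,N$, $M\ge 1$) be observed data. For invertible demixing matrices $W_f=[\,w_f\ J_f\,]^{\mathsf H}$, with $w_f\in\mathbb C^M$ and $J_f\in\mathbb C^{M\times(M-1)}$, let $x_{fn}=W_f^{-1}(s_{fn},z_{fn})$, where the target $s$ and the background $z$ are independent, the frames are independent, $(s_{1n},\dots,s_{Fn})$ has on $\mathbb C^F$ a density proportional to $\exp\bigl(-G_n(\sqrt{\sum_f|s_{fn}|^2})\bigr)$, and $z_{fn}$ is centred circular complex Gaussian with positive definite covariance $B_f$, independent over $f$. Here each $G_n:[0,\infty)\to\mathbb R$ is continuous, strictly increasing and differentiable on $(0,\infty)$, $G_n'(r)/r$ is strictly decreasing there, and $\exp(-G_n(\|s\|))$ is integrable. Let $\mathcal L(w,J)$ be the negative log-likelihood of $x$, i.e. $$\mathcal L=-2N\sum_f\log|\det W_f|+\sum_nG_n(r_n)+\sum_{f,n}x_{fn}^{\mathsf H}J_fB_f^{-1}J_f^{\mathsf H}x_{fn}+\mathrm{const},\qquad r_n=\Bigl(\sum_f|w_f^{\mathsf H}x_{fn}|^2\Bigr)^{1/2}.$$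 Put $\varphi_n(r)=G_n'(r)/(2r)$ for $r>0$ and $\varphi_n(0)=\lim_{r\to0+}\varphi_n(r)$; the weight is *defined* at $r$ if $r>0$, or if $r=0$ and this limit is finite. **Algorithm FIVE.** Let $C_f=\frac1N\sum_nx_{fn}x_{fn}^{\mathsf H}=Q_f^{\mathsf H}Q_f$ with $Q_f$ invertible, and $\tilde x_{fn}=Q_f^{-\mathsf H}x_{fn}$. From the current estimate $\hat s$ (initially arbitrary) an iteration computes $r_n=(\sum_f|\hat s_{fn}|^2)^{1/2}$ for all $n$ and then, for each $f$, a smallest eigenvalue $\lambda_f$ of $\tilde V_f=\frac1N\sum_n\varphi_n(r_n)\tilde x_{fn}\tilde x_{fn}^{\mathsf H}$ with any unit eigenvector $v_f$, the filter $u_f=\lambda_f^{-1/2}v_f$, and the new estimate $\hat s_{fn}=u_f^{\mathsf H}\tilde x_{fn}$. In the original coordinates the filter is $w_f=Q_f^{-1}u_f$. Consider an infinite run in which all weights are defined (no division by zero occurs), and for magnitudes $r$ the auxiliary function $$\mathcal L_2(w,J;r)=-2N\sum_f\log|\det W_f|+N\sum_fw_f^{\mathsf H}V_fw_f+N\sum_f\operatorname{tr}(J_f^{\mathsf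 H}C_fJ_fB_f^{-1})+\mathrm{const}(r),\quad V_f=\tfrac1N\sum_n\varphi_n(r_n)x_{fn}x_{fn}^{\mathsf H},$$ where $\mathrm{const}(r)$ contains $\sum_n(G_n(r_n)-\varphi_n(r_n)r_n^2)$ and the constant of $\mathcal L$. **Theorem 1.** 1. For all invertible $W_f$ the law of the mixture has the density whose negative logarithm is $\mathcal L$. 2. $\mathcal L\le\mathcal L_2(\cdot\,;r)$ on all invertible parameters whenever the weights are defined at $r$, with equality at each $(w,J)$ whose magnitudes are $r$. 3. The filters $w^k$ of the iterations can be completed by $J^k$ such that, for every $k$, $\theta^k=(w^k,J^k)$ is a global minimizer (over all invertible parameters) of the auxiliary function at the magnitudes of iteration $k$. 4. For every such completion: $\mathcal L(\theta^k)$ is non-increasing; every limit point of $(\theta^k)$ at which all weights are defined is a stationary point of $\mathcal L$ (the $W_f$ are invertible and $\mathcal L$ is differentiable with derivative $0$). 5. If $(\theta^k)$ stays in a compact set of parameters with invertible $W_f$ and defined weights, then it converges to the stationary points of $\mathcal L$: $\mathcal L(\theta^k)$ converges to some $c$, and the distance of $\theta^k$ to the set of stationary points with $\mathcal L=c$ tends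 to $0$. Such a compact set exists whenever, for all $n$, $\varphi_n(0)$ is finite and $G_n(r)-2NF\log r\to\infty$ as $r\to\infty$. 6. If, in the situation of 5, the target filters $w$ of the stationary points with defined weights are isolated up to a phase in each $f$, and at each of these points the smallest eigenvalues of the corresponding $\tilde V_f$ are simple, then there is one stationary point $(w^*,J^*)$ such that $w^k$ converges to $w^*$ up to unimodular factors in each $f$. -/

import Mathlib

open MeasureTheory Filter Topology
open scoped Matrix ComplexOrder

noncomputable section

/-- Multichannel data `x n f : ℂ^M`, with `N` frames, `F` frequency bins and `M = d + 1` channels. -/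
abbrev Data (N F d : ℕ) : Type := Fin N → Fin F → Fin (d + 1) → ℂ

/-- The parameters of the model: `θ f i` is the `i`-th column of `[w_f  J_f]`, so that
`θ f 0 = w_f` extracts the target and the `θ f i.succ` are the `d` columns of `J_f`. -/
abbrev Filters (F d : ℕ) : Type := Fin F → Fin (d + 1) → Fin (d + 1) → ℂ

/-- The demixing matrix `W_f = [w_f  J_f]ᴴ`. -/
def demix {F d : ℕ} (θ : Filters F d) (f : Fin F) : Matrix (Fin (d + 1)) (Fin (d + 1)) ℂ :=
  Matrix.of fun i j => star (θ f i j)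

/-- All demixing matrices are invertible. -/
def Nondegenerate {F d : ℕ} (θ : Filters F d) : Prop :=
  ∀ f, (demix θ f).det ≠ 0

/-- The target estimate `w_fᴴ x_{fn}` in frame `n` (as a vector indexed by `f`). -/
def target {N F d : ℕ} (θ : Filters F d) (x : Data N F d) (n : Fin N) : Fin F → ℂ :=
  fun f => star (θ f 0) ⬝ᵥ x n f

/-- The background estimate `J_fᴴ x_{fn}`. -/
def background {N F d : ℕ} (θ : Filters F d) (x : Data N F d) (n : Fin N) (f : Fin F) :
    Fin d → ℂ :=
  fun i => star (θ f i.succ) ⬝ᵥ x n f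

/-- The magnitude `√(∑_f |s_f|²)` of one frame of the target. -/
def activity {F : ℕ} (s : Fin F → ℂ) : ℝ :=
  Real.sqrt (∑ f, ‖s f‖ ^ 2)

/-- `G : ℝ₊ → ℝ` is strictly increasing and differentiable, and `G'(r) / r` is strictly
decreasing. At the end point `0` only continuity is asked for. -/
structure IsSuperGaussian (G : ℝ → ℝ) : Prop where
  strictMono : StrictMonoOn G (Set.Ici 0)
  continuous : ContinuousOn G (Set.Ici 0)
  differentiable : DifferentiableOn ℝ G (Set.Ioi 0)
  strictAnti : StrictAntiOn (fun r => deriv G r / r) (Set.Ioi 0)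

/-! ### The probabilistic model -/

/-- The normalizing constant of the spherical density proportional to `exp (-G ‖s‖)` on `ℂ^F`. -/
def sourceMass (F : ℕ) (G : ℝ → ℝ) : ℝ :=
  ∫ s : Fin F → ℂ, Real.exp (-G (activity s))

/-- The spherical density proportional to `exp (-G ‖s‖)` on `ℂ^F`. -/
def sourceDensity {F : ℕ} (G : ℝ → ℝ) (s : Fin F → ℂ) : ℝ :=
  (sourceMass F G)⁻¹ * Real.exp (-G (activity s))

/-- The density of the centred circular complex Gaussian vector with covariance matrix `B`. -/
def gaussianDensity {d : ℕ} (B : Matrix (Fin d) (Fin d) ℂ) (z : Fin d → ℂ) : ℝ :=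
  (Real.pi ^ d * ‖B.det‖)⁻¹ * Real.exp (-(star z ⬝ᵥ (B⁻¹ *ᵥ z)).re)

/-- The law of the target: independent frames, frame `n` with density `∝ exp (-G_n ‖s‖)`. -/
def sourceLaw {N : ℕ} (F : ℕ) (G : Fin N → ℝ → ℝ) : Measure (Fin N → Fin F → ℂ) :=
  Measure.pi fun n =>
    (volume : Measure (Fin F → ℂ)).withDensity fun s => ENNReal.ofReal (sourceDensity (G n) s)

/-- The law of the (demixed) background: Gaussian with covariance `B f` across the channels at
frequency `f`, independent over frequencies and frames. -/
def backgroundLaw (N : ℕ) {F d : ℕ} (B : Fin F → Matrix (Fin d) (Fin d) ℂ) :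
    Measure (Fin N → Fin F → Fin d → ℂ) :=
  Measure.pi fun _ => Measure.pi fun f =>
    (volume : Measure (Fin d → ℂ)).withDensity fun z => ENNReal.ofReal (gaussianDensity (B f) z)

/-- The mixture `x_{fn} = W_f⁻¹ (s_{fn}, z_{fn})`. -/
def mix {N F d : ℕ} (θ : Filters F d)
    (y : (Fin N → Fin F → ℂ) × (Fin N → Fin F → Fin d → ℂ)) : Data N F d :=
  fun n f => (demix θ f)⁻¹ *ᵥ (Fin.cons (y.1 n f) (y.2 n f) : Fin (d + 1) → ℂ)

/-- The law of the observed mixture; target and background are independent. -/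
def observedLaw {N F d : ℕ} (G : Fin N → ℝ → ℝ) (B : Fin F → Matrix (Fin d) (Fin d) ℂ)
    (θ : Filters F d) : Measure (Data N F d) :=
  ((sourceLaw F G).prod (backgroundLaw N B)).map (mix θ)

/-- The likelihood of `θ` given the observed mixture `x`. -/
def likelihood {N F d : ℕ} (G : Fin N → ℝ → ℝ) (B : Fin F → Matrix (Fin d) (Fin d) ℂ)
    (x : Data N F d) (θ : Filters F d) : ℝ :=
  ∏ n, (sourceDensity (G n) (target θ x n) *
    ∏ f, (‖(demix θ f).det‖ ^ 2 * gaussianDensity (B f) (background θ x n f)))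

/-- The negative log-likelihood of `θ` given the observed mixture `x`. -/
def negLogLik {N F d : ℕ} (G : Fin N → ℝ → ℝ) (B : Fin F → Matrix (Fin d) (Fin d) ℂ)
    (x : Data N F d) (θ : Filters F d) : ℝ :=
  -Real.log (likelihood G B x θ)

/-- Stationary points of the negative log-likelihood: all demixing matrices are invertible, and
the function is (real) differentiable at `θ` with derivative zero. -/
def IsStationaryPt {N F d : ℕ} (G : Fin N → ℝ → ℝ) (B : Fin F → Matrix (Fin d) (Fin d) ℂ)
    (x : Data N F d) (θ : Filters F d) : Prop :=
  Nondegenerate θ ∧ HasFDerivAt (negLogLik G B x) (0 : Filters F d →L[ℝ] ℝ) θ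

/-! ### The weights -/

/-- `G'(r) / (2 r)` has a finite limit as `r → 0+`. -/
def FiniteAtZero (G : ℝ → ℝ) : Prop :=
  ∃ c : ℝ, Tendsto (fun t => deriv G t / (2 * t)) (𝓝[>] 0) (𝓝 c)

/-- The weight `φ(r) = G'(r) / (2 r)`; at `r = 0` it is the limit, if there is one. -/
def weight (G : ℝ → ℝ) (r : ℝ) : ℝ :=
  if 0 < r then deriv G r / (2 * r) else limUnder (𝓝[>] 0) fun t => deriv G t / (2 * t)

/-- The weight is well defined at `r`: no division by zero occurs. -/
def WeightDefined (G : ℝ → ℝ) (r : ℝ) : Prop :=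
  0 < r ∨ (r = 0 ∧ FiniteAtZero G)

/-- The filters are nondegenerate and all the weights are well defined at their output. -/
def Admissible {N F d : ℕ} (G : Fin N → ℝ → ℝ) (x : Data N F d) (θ : Filters F d) : Prop :=
  Nondegenerate θ ∧ ∀ n, WeightDefined (G n) (activity (target θ x n))

/-! ### The algorithm -/

/-- The weighted covariance matrix `V_f = (1/N) ∑_n φ_n(r_n) x_{fn} x_{fn}ᴴ`. -/
def weightedCov {N F d : ℕ} (φ : Fin N → ℝ → ℝ) (r : Fin N → ℝ) (x : Data N F d) (f : Fin F) :
    Matrix (Fin (d + 1)) (Fin (d + 1)) ℂ :=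
  (1 / (N : ℂ)) • ∑ n, (φ n (r n) : ℂ) • Matrix.vecMulVec (x n f) (star (x n f))

/-- The sample covariance matrix `C_f = (1/N) ∑_n x_{fn} x_{fn}ᴴ`. -/
def sampleCov {N F d : ℕ} (x : Data N F d) (f : Fin F) : Matrix (Fin (d + 1)) (Fin (d + 1)) ℂ :=
  (1 / (N : ℂ)) • ∑ n, Matrix.vecMulVec (x n f) (star (x n f))

/-- The whitened data `Q_f⁻ᴴ x_{fn}`. -/
def whiten {N F d : ℕ} (Q : Fin F → Matrix (Fin (d + 1)) (Fin (d + 1)) ℂ) (x : Data N F d) :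
    Data N F d :=
  fun n f => ((Q f)ᴴ)⁻¹ *ᵥ x n f

/-- `l` is the smallest (real) eigenvalue of `A`. -/
def IsSmallestEigenvalue {m : ℕ} (A : Matrix (Fin m) (Fin m) ℂ) (l : ℝ) : Prop :=
  IsLeast {t : ℝ | Module.End.HasEigenvalue (Matrix.toLin' A) (t : ℂ)} l

/-- An infinite run of the algorithm FIVE on the whitened data `xt` with weights `φ`. Here `s 0` is
the initial estimate of the target; iteration `k` computes the filters `u k` from the estimate
`s k`, and then the new estimate `s (k + 1)`. Any choice of the unit eigenvectors is allowed. -/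
structure IsFIVERun {N F d : ℕ} (φ : Fin N → ℝ → ℝ) (xt : Data N F d)
    (s : ℕ → Fin N → Fin F → ℂ) (u : ℕ → Fin F → Fin (d + 1) → ℂ) : Prop where
  filter_step : ∀ k f, ∃ (l : ℝ) (v : Fin (d + 1) → ℂ),
    IsSmallestEigenvalue (weightedCov φ (fun n => activity (s k n)) xt f) l ∧
    weightedCov φ (fun n => activity (s k n)) xt f *ᵥ v = (l : ℂ) • v ∧
    star v ⬝ᵥ v = 1 ∧
    u k f = (((Real.sqrt l)⁻¹ : ℝ) : ℂ) • v
  estimate_step : ∀ k n f, s (k + 1) n f = star (u k f) ⬝ᵥ xt n f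

/-! ### The auxiliary function -/

/-- The part of the negative log-likelihood that does not depend on `θ` and `x`. -/
def normalization {N F d : ℕ} (G : Fin N → ℝ → ℝ) (B : Fin F → Matrix (Fin d) (Fin d) ℂ) : ℝ :=
  ∑ n, Real.log (sourceMass F (G n)) + N * ∑ f, Real.log (Real.pi ^ d * ‖(B f).det‖)

/-- The matrix `J_f` of the last `d` columns of `[w_f  J_f]`. -/
def backgroundFilter {F d : ℕ} (θ : Filters F d) (f : Fin F) : Matrix (Fin (d + 1)) (Fin d) ℂ :=
  Matrix.of fun j i => θ f i.succ j

/-- The auxiliary function at the magnitudes `r`, as a function of `θ`: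
`-2N ∑_f log |det W_f| + N ∑_f w_fᴴ V_f w_f + N ∑_f tr (J_fᴴ C_f J_f B_f⁻¹) + const`. -/
def auxiliary {N F d : ℕ} (G : Fin N → ℝ → ℝ) (B : Fin F → Matrix (Fin d) (Fin d) ℂ)
    (x : Data N F d) (r : Fin N → ℝ) (θ : Filters F d) : ℝ :=
  -2 * N * ∑ f, Real.log ‖(demix θ f).det‖
    + N * ∑ f, (star (θ f 0) ⬝ᵥ (weightedCov (fun n => weight (G n)) r x f *ᵥ θ f 0)).re
    + N * ∑ f, (Matrix.trace
        ((backgroundFilter θ f)ᴴ * sampleCov x f * backgroundFilter θ f * (B f)⁻¹)).re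
    + (∑ n, (G n (r n) - weight (G n) (r n) * r n ^ 2) + normalization G B)

/-- `θ k` completes the filters `w_f = Q_f⁻¹ u_f` found by iteration `k` of the run with
background filters `J_f`, in such a way that it minimizes globally the auxiliary function of that
iteration. -/
def IsCompletion {N F d : ℕ} (G : Fin N → ℝ → ℝ) (B : Fin F → Matrix (Fin d) (Fin d) ℂ)
    (x : Data N F d) (Q : Fin F → Matrix (Fin (d + 1)) (Fin (d + 1)) ℂ)
    (s : ℕ → Fin N → Fin F → ℂ) (u : ℕ → Fin F → Fin (d + 1) → ℂ) (θ : ℕ → Filters F d) : Prop :=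
  ∀ k, (∀ f, θ k f 0 = (Q f)⁻¹ *ᵥ u k f) ∧ Nondegenerate (θ k) ∧
    ∀ η, Nondegenerate η →
      auxiliary G B x (fun n => activity (s k n)) (θ k)
        ≤ auxiliary G B x (fun n => activity (s k n)) η

/-- The sequence stays in a compact set of admissible parameters. -/
def IsConfined {N F d : ℕ} (G : Fin N → ℝ → ℝ) (x : Data N F d) (θ : ℕ → Filters F d) : Prop :=
  ∃ K : Set (Filters F d), IsCompact K ∧ (∀ η ∈ K, Admissible G x η) ∧ ∀ k, θ k ∈ K

end

/-!
FIVE is a majorize-minimize algorithm, and its convergence follows from three facts.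

*Majorization.* As `G'(r) / r` decreases, `t ↦ G √t` is concave, with derivative `φ (√t)`. The
tangent bound `G q ≤ G r + φ r (q² - r²)` (`IsSuperGaussian.le_tangent`), summed over the frames,
is the inequality between `negLogLik` and `auxiliary` (`auxiliary_sub_negLogLik`). The derivative
`φ (√t)` is strictly monotone and has the intermediate value property, so the weights are
continuous.

*Minimization.* The auxiliary function is a sum over the frequencies. In whitened coordinates,
each summand is at least `-log |det A|² + ‖A‖²` up to constants, where the first column of `A` is
the target filter times `√λ`, with `λ` the smallest eigenvalue, and the other columns are the
normalized background filters; equality holds if the target filter is a `λ`-eigenvector. The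
inequality `log det H ≤ tr H - m` for `H = Aᴴ A` bounds this from below, with equality exactly for
unitary `A`. Hence a minimizer has a `λ`-eigenvector of length `1 / √λ` as its target filter,
and every unit eigenvector yields one, on completing it to a unitary matrix
(`exists_isLeast_auxiliaryAt`).

*Limits.* Along a majorize-minimize sequence (`IsMajMinSeq`) the objective decreases, which keeps
limit points nondegenerate. Since `L(η) ≤ L(θ (k + 1)) ≤ auxiliary (r (θ k)) ζ` for every `ζ` and
`k`, a limit point `η` minimizes its own auxiliary function; that function touches `L` from above
at `η`, so the derivative of `L` vanishes there (`isStationaryPt_of_minimizes`). Limits are taken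
along ultrafilters, which plays the role of passing to subsequences. A confined sequence has limit
points along every ultrafilter, which gives convergence to the stationary set. Confinement under
the growth condition is coercivity: the logarithms of all the target filters are dominated by the
one term `G n R` with the largest magnitude `R` (`exists_bound_of_negLogLik_le`).

For the convergence up to phases, the limits of `θ k` and `θ (k + 1)` minimize the same auxiliary
function, and so have the same target filters up to phases if the eigenvalues are simple. The
distance up to phases of `θ k` to a limit point therefore has vanishing increments, while
isolation excludes small positive cluster values; such a sequence tends to `0`
(`tendsto_zero_of_cluster_gap`).

The law of the mixture is computed by Tonelli's theorem and the fact that a complex matrix scales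
the volume by the square of the modulus of its determinant (`observedLaw_eq`).
-/

noncomputable section

/-! ### The weights -/

namespace IsSuperGaussian

variable {G : ℝ → ℝ} (hG : IsSuperGaussian G)
include hG

/-- Monotonicity alone gives `0 ≤ G'`; a zero of `G'` is excluded because `G'(r) / r` is strictly
decreasing and nonnegative. -/
theorem deriv_pos {r : ℝ} (hr : 0 < r) : 0 < deriv G r := by
  have nonneg : ∀ t, 0 < t → 0 ≤ deriv G t := fun t ht => by
    have h := hG.strictMono.monotoneOn.derivWithin_nonneg (x := t)
    rwa [derivWithin_of_mem_nhds (Ici_mem_nhds ht)] at h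
  have h := hG.strictAnti (Set.mem_Ioi.2 hr) (Set.mem_Ioi.2 (by linarith : 0 < r + 1))
    (by linarith : r < r + 1)
  have h' : 0 ≤ deriv G (r + 1) / (r + 1) := div_nonneg (nonneg _ (by linarith)) (by linarith)
  have h'' : 0 < deriv G r / r := lt_of_le_of_lt h' h
  exact (div_pos_iff_of_pos_right hr).1 h''

theorem hasDerivAt_comp_sqrt {t : ℝ} (ht : 0 < t) :
    HasDerivAt (fun t => G (Real.sqrt t)) (weight G (Real.sqrt t)) t := by
  have hs : 0 < Real.sqrt t := Real.sqrt_pos.2 ht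
  have h1 : HasDerivAt G (deriv G (Real.sqrt t)) (Real.sqrt t) :=
    ((hG.differentiable _ hs).differentiableAt (Ioi_mem_nhds hs)).hasDerivAt
  refine (h1.comp t (Real.hasDerivAt_sqrt ht.ne')).congr_deriv ?_
  simp only [weight, if_pos hs]
  ring

theorem weight_strictAntiOn : StrictAntiOn (weight G) (Set.Ioi 0) := by
  intro a ha b hb hab
  have h := hG.strictAnti ha hb hab
  simp only [Set.mem_Ioi] at ha hb
  simp only [weight, if_pos ha, if_pos hb]
  rw [mul_comm 2 a, mul_comm 2 b, ← div_div, ← div_div]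
  exact div_lt_div_of_pos_right h two_pos

theorem continuousOn_comp_sqrt : ContinuousOn (fun t => G (Real.sqrt t)) (Set.Ici 0) :=
  hG.continuous.comp Real.continuous_sqrt.continuousOn fun t _ => Real.sqrt_nonneg t

theorem concaveOn_comp_sqrt : ConcaveOn ℝ (Set.Ici 0) fun t => G (Real.sqrt t) := by
  refine AntitoneOn.concaveOn_of_deriv (convex_Ici 0) hG.continuousOn_comp_sqrt ?_ ?_
  · rw [interior_Ici]
    exact fun t ht => (hG.hasDerivAt_comp_sqrt ht).differentiableAt.differentiableWithinAt
  · rw [interior_Ici]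
    intro a ha b hb hab
    rw [(hG.hasDerivAt_comp_sqrt ha).deriv, (hG.hasDerivAt_comp_sqrt hb).deriv]
    exact hG.weight_strictAntiOn.antitoneOn (Real.sqrt_pos.2 ha) (Real.sqrt_pos.2 hb)
      (Real.sqrt_le_sqrt hab)

theorem le_tangent_of_pos {r q : ℝ} (hr : 0 < r) (hq : 0 ≤ q) :
    G q ≤ G r + weight G r * (q ^ 2 - r ^ 2) := by
  have hd : HasDerivAt (fun t => G (Real.sqrt t)) (weight G r) (r ^ 2) := by
    have h := hG.hasDerivAt_comp_sqrt (t := r ^ 2) (by positivity)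
    rwa [Real.sqrt_sq hr.le] at h
  have key := hG.concaveOn_comp_sqrt
  have hr2 : r ^ 2 ∈ Set.Ici (0 : ℝ) := Set.mem_Ici.2 (by positivity)
  have hq2 : q ^ 2 ∈ Set.Ici (0 : ℝ) := Set.mem_Ici.2 (by positivity)
  rcases lt_trichotomy (q ^ 2) (r ^ 2) with h | h | h
  · have := key.le_slope_of_hasDerivAt hq2 hr2 h hd
    rw [slope_def_field, le_div_iff₀ (by linarith)] at this
    simp only [Real.sqrt_sq hr.le, Real.sqrt_sq hq] at this
    linarith
  · have : q = r := by
      have := congrArg Real.sqrt h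
      rwa [Real.sqrt_sq hr.le, Real.sqrt_sq hq] at this
    simp [this]
  · have := key.slope_le_of_hasDerivAt hr2 hq2 h hd
    rw [slope_def_field, div_le_iff₀ (by linarith)] at this
    simp only [Real.sqrt_sq hr.le, Real.sqrt_sq hq] at this
    linarith

omit hG in
/-- If the limit defining the weight at `0` exists, then `limUnder` is that limit. -/
theorem tendsto_weight_zero (h0 : FiniteAtZero G) :
    Tendsto (weight G) (𝓝[>] 0) (𝓝 (weight G 0)) := by
  have h1 : weight G 0 = limUnder (𝓝[>] 0) fun t => deriv G t / (2 * t) := by simp [weight]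
  rw [h1]
  refine (tendsto_nhds_limUnder h0).congr' ?_
  filter_upwards [self_mem_nhdsWithin] with t ht
  simp only [weight, if_pos (Set.mem_Ioi.1 ht)]

/-- The tangent bound of the concave function `t ↦ G √t`. -/
theorem le_tangent {r q : ℝ} (hr : WeightDefined G r) (hq : 0 ≤ q) :
    G q ≤ G r + weight G r * (q ^ 2 - r ^ 2) := by
  rcases hr with hr | ⟨rfl, h0⟩
  · exact hG.le_tangent_of_pos hr hq
  -- at `r = 0`, the bound is the limit of the tangent bounds at `r > 0`
  · have h1 : Tendsto G (𝓝[>] 0) (𝓝 (G 0)) :=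
      (hG.continuous 0 (by simp)).mono_left (nhdsWithin_mono _ Set.Ioi_subset_Ici_self)
    have h2 : Tendsto (fun r : ℝ => q ^ 2 - r ^ 2) (𝓝[>] 0) (𝓝 (q ^ 2 - 0 ^ 2)) :=
      (Continuous.tendsto (by fun_prop) 0).mono_left nhdsWithin_le_nhds
    refine ge_of_tendsto (h1.add ((tendsto_weight_zero h0).mul h2)) ?_
    filter_upwards [self_mem_nhdsWithin] with t ht
    exact hG.le_tangent_of_pos ht hq

theorem weight_pos {r : ℝ} (hr : WeightDefined G r) : 0 < weight G r := by
  have pos : ∀ t, 0 < t → 0 < weight G t := fun t ht => by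
    rw [weight, if_pos ht]
    exact div_pos (hG.deriv_pos ht) (by linarith)
  rcases hr with hr | ⟨rfl, h0⟩
  · exact pos r hr
  · refine lt_of_lt_of_le (pos 1 one_pos) (ge_of_tendsto (tendsto_weight_zero h0) ?_)
    filter_upwards [Ioo_mem_nhdsGT (zero_lt_one' ℝ)] with t ht
    exact (hG.weight_strictAntiOn ht.1 (Set.mem_Ioi.2 one_pos) ht.2).le

/-- The weight, being the strictly monotone derivative of `t ↦ G √t` at `t = r²`, has the
intermediate value property and therefore no jumps. -/
theorem continuousAt_weight {r : ℝ} (hr : 0 < r) : ContinuousAt (weight G) r := by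
  set m : ℝ → ℝ := fun t => -weight G (Real.sqrt t) with hm
  have hmono : StrictMonoOn m (Set.Ioi 0) := fun a ha b hb hab =>
    neg_lt_neg (hG.weight_strictAntiOn (Real.sqrt_pos.2 ha) (Real.sqrt_pos.2 hb)
      (Real.sqrt_lt_sqrt (le_of_lt ha) hab))
  have himg : (m '' Set.Ioi 0).OrdConnected :=
    Set.ordConnected_Ioi.image_hasDerivWithinAt (f := fun t => -G (Real.sqrt t)) fun t ht =>
      (hG.hasDerivAt_comp_sqrt ht).neg.hasDerivWithinAt
  have hcont : ∀ a, 0 < a → ContinuousAt m a := fun a ha => by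
    refine continuousAt_of_monotoneOn_of_image_mem_nhds hmono.monotoneOn (Ioi_mem_nhds ha) ?_
    have h1 : a / 2 ∈ Set.Ioi (0 : ℝ) := Set.mem_Ioi.2 (by linarith)
    have h2 : 2 * a ∈ Set.Ioi (0 : ℝ) := Set.mem_Ioi.2 (by linarith)
    exact mem_of_superset
      (Icc_mem_nhds (hmono h1 ha (by linarith)) (hmono ha h2 (by linarith)))
      (himg.out (Set.mem_image_of_mem _ h1) (Set.mem_image_of_mem _ h2))
  have h := (hcont (r ^ 2) (by positivity)).comp (f := fun r : ℝ => r ^ 2) (by fun_prop)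
  refine h.neg.congr ?_
  filter_upwards [Ioi_mem_nhds hr] with t ht
  simp [hm, Real.sqrt_sq (le_of_lt (Set.mem_Ioi.1 ht))]

theorem continuousWithinAt_weight {r : ℝ} (hr : WeightDefined G r) :
    ContinuousWithinAt (weight G) (Set.Ici 0) r := by
  rcases hr with hr | ⟨rfl, h0⟩
  · exact (hG.continuousAt_weight hr).continuousWithinAt
  · rw [← Set.Ioi_insert, continuousWithinAt_insert_self]
    exact tendsto_weight_zero h0

end IsSuperGaussian

/-! ### Determinants, smallest eigenvalues and unitary completions -/

namespace Matrix

variable {m : ℕ}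

theorem dotProduct_star_self_eq_sum_sq {ι : Type*} [Fintype ι] (v : ι → ℂ) :
    star v ⬝ᵥ v = ((∑ i, ‖v i‖ ^ 2 : ℝ) : ℂ) := by
  simp only [dotProduct, Pi.star_apply, RCLike.star_def, Complex.conj_mul', Complex.ofReal_sum,
    Complex.ofReal_pow]

theorem trace_conjTranspose_mul_self_eq_sum_sq {ι κ : Type*} [Fintype ι] [Fintype κ]
    (A : Matrix ι κ ℂ) : (Aᴴ * A).trace = ((∑ j, ∑ i, ‖A i j‖ ^ 2 : ℝ) : ℂ) := by
  simp only [trace, diag_apply, mul_apply, conjTranspose_apply, RCLike.star_def, Complex.conj_mul',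
    Complex.ofReal_sum, Complex.ofReal_pow]

theorem PosDef.log_det_le {H : Matrix (Fin m) (Fin m) ℂ} (hH : H.PosDef) :
    Real.log H.det.re ≤ H.trace.re - m := by
  have h1 : H.det.re = ∏ i, hH.1.eigenvalues i := by
    rw [hH.1.det_eq_prod_eigenvalues]
    exact_mod_cast congrArg Complex.re (Complex.ofReal_prod Finset.univ hH.1.eigenvalues).symm
  have h2 : H.trace.re = ∑ i, hH.1.eigenvalues i := by
    rw [hH.1.trace_eq_sum_eigenvalues]
    exact_mod_cast congrArg Complex.re (Complex.ofReal_sum Finset.univ hH.1.eigenvalues).symm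
  have h3 : (m : ℝ) = ∑ _i : Fin m, (1 : ℝ) := by simp
  rw [h1, h2, h3, Real.log_prod fun i _ => (hH.eigenvalues_pos i).ne', ← Finset.sum_sub_distrib]
  exact Finset.sum_le_sum fun i _ => Real.log_le_sub_one_of_pos (hH.eigenvalues_pos i)

/-- Equality in `log det H ≤ tr H - m` forces all eigenvalues of `H` to be `1`. -/
theorem PosDef.eq_one_of_log_det_eq {H : Matrix (Fin m) (Fin m) ℂ} (hH : H.PosDef)
    (h : H.trace.re - m ≤ Real.log H.det.re) : H = 1 := by
  have h1 : H.det.re = ∏ i, hH.1.eigenvalues i := by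
    rw [hH.1.det_eq_prod_eigenvalues]
    exact_mod_cast congrArg Complex.re (Complex.ofReal_prod Finset.univ hH.1.eigenvalues).symm
  have h2 : H.trace.re = ∑ i, hH.1.eigenvalues i := by
    rw [hH.1.trace_eq_sum_eigenvalues]
    exact_mod_cast congrArg Complex.re (Complex.ofReal_sum Finset.univ hH.1.eigenvalues).symm
  have h3 : (m : ℝ) = ∑ _i : Fin m, (1 : ℝ) := by simp
  rw [h1, h2, h3, Real.log_prod fun i _ => (hH.eigenvalues_pos i).ne',
    ← Finset.sum_sub_distrib] at h
  have h4 : ∀ i, hH.1.eigenvalues i = 1 := by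
    by_contra! hne
    obtain ⟨i, hi⟩ := hne
    exact absurd h (not_le.2 (Finset.sum_lt_sum
      (fun i _ => Real.log_le_sub_one_of_pos (hH.eigenvalues_pos i))
      ⟨i, Finset.mem_univ i, Real.log_lt_sub_one_of_pos (hH.eigenvalues_pos i) hi⟩))
  have h5 := hH.1.spectral_theorem
  have h6 : diagonal (RCLike.ofReal ∘ hH.1.eigenvalues : Fin m → ℂ) = 1 := by
    rw [← diagonal_one]
    congr 1
    funext i
    simp [h4 i]
  rw [h6, map_one] at h5
  exact h5

theorem re_det_conjTranspose_mul_self (A : Matrix (Fin m) (Fin m) ℂ) :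
    (Aᴴ * A).det.re = ‖A.det‖ ^ 2 := by
  rw [det_mul, det_conjTranspose, RCLike.star_def, Complex.conj_mul', ← Complex.ofReal_pow,
    Complex.ofReal_re]

theorem posDef_conjTranspose_mul_self_of_det_ne_zero {A : Matrix (Fin m) (Fin m) ℂ}
    (hA : A.det ≠ 0) : (Aᴴ * A).PosDef :=
  PosDef.conjTranspose_mul_self A (mulVec_injective_iff_isUnit.2
    ((isUnit_iff_isUnit_det A).2 (isUnit_iff_ne_zero.2 hA)))

theorem log_norm_det_sq_le {A : Matrix (Fin m) (Fin m) ℂ} (hA : A.det ≠ 0) :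
    Real.log (‖A.det‖ ^ 2) ≤ (∑ j, ∑ i, ‖A i j‖ ^ 2) - m := by
  have h := (posDef_conjTranspose_mul_self_of_det_ne_zero hA).log_det_le
  rwa [re_det_conjTranspose_mul_self, trace_conjTranspose_mul_self_eq_sum_sq,
    Complex.ofReal_re] at h

theorem conjTranspose_mul_self_eq_one_of_log_norm_det {A : Matrix (Fin m) (Fin m) ℂ}
    (hA : A.det ≠ 0) (h : (∑ j, ∑ i, ‖A i j‖ ^ 2) - m ≤ Real.log (‖A.det‖ ^ 2)) :
    Aᴴ * A = 1 := by
  refine (posDef_conjTranspose_mul_self_of_det_ne_zero hA).eq_one_of_log_det_eq ?_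
  rwa [re_det_conjTranspose_mul_self, trace_conjTranspose_mul_self_eq_sum_sq, Complex.ofReal_re]

theorem norm_det_sq_of_conjTranspose_mul_self {A : Matrix (Fin m) (Fin m) ℂ} (h : Aᴴ * A = 1) :
    ‖A.det‖ ^ 2 = 1 := by
  rw [← re_det_conjTranspose_mul_self, h, det_one, Complex.one_re]

theorem sum_sq_col_of_conjTranspose_mul_self {A : Matrix (Fin m) (Fin m) ℂ} (h : Aᴴ * A = 1)
    (j : Fin m) : ∑ i, ‖A i j‖ ^ 2 = 1 := by
  have h1 : (Aᴴ * A) j j = 1 := by rw [h, one_apply_eq]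
  have h2 : (Aᴴ * A) j j = ((∑ i, ‖A i j‖ ^ 2 : ℝ) : ℂ) := by
    simp only [mul_apply, conjTranspose_apply, RCLike.star_def, Complex.conj_mul',
      Complex.ofReal_sum, Complex.ofReal_pow]
  exact_mod_cast h2.symm.trans h1

/-- A unit vector is the first column of a unitary matrix. -/
theorem exists_unitary_first_column {d : ℕ} {v : Fin (d + 1) → ℂ} (hv : star v ⬝ᵥ v = 1) :
    ∃ A : Matrix (Fin (d + 1)) (Fin (d + 1)) ℂ, Aᴴ * A = 1 ∧ ∀ i, A i 0 = v i := by
  have hv' : ‖(WithLp.toLp 2 v : EuclideanSpace ℂ (Fin (d + 1)))‖ = 1 := by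
    rw [EuclideanSpace.norm_eq, Real.sqrt_eq_one]
    rw [dotProduct_star_self_eq_sum_sq] at hv
    exact_mod_cast hv
  have ho : Orthonormal ℂ (({0} : Set (Fin (d + 1))).domRestrict
      fun _ => (WithLp.toLp 2 v : EuclideanSpace ℂ (Fin (d + 1)))) := by
    constructor
    · intro i
      simpa using hv'
    · intro i j hij
      exact absurd (Subsingleton.elim i j) hij
  obtain ⟨b, hb⟩ := ho.exists_orthonormalBasis_extension_of_card_eq (by simp)
  refine ⟨of fun i j => b j i, ?_, fun i => ?_⟩
  · ext j k
    have h := orthonormal_iff_ite.1 b.orthonormal j k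
    rw [one_apply, ← h, mul_apply, PiLp.inner_apply]
    refine Finset.sum_congr rfl fun i _ => ?_
    simp [mul_comm]
  · simp [hb 0 rfl]

theorem IsHermitian.posSemidef_sub_smallest {A : Matrix (Fin m) (Fin m) ℂ} (hA : A.IsHermitian)
    {l : ℝ} (hl : IsSmallestEigenvalue A l) :
    (A - (l : ℂ) • (1 : Matrix (Fin m) (Fin m) ℂ)).PosSemidef := by
  have hH : (A - (l : ℂ) • (1 : Matrix (Fin m) (Fin m) ℂ)).IsHermitian := by
    refine hA.sub ?_
    rw [IsHermitian, conjTranspose_smul, conjTranspose_one, RCLike.star_def, Complex.conj_ofReal]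
  rw [hH.posSemidef_iff_eigenvalues_nonneg]
  intro i
  have h1 := hH.mulVec_eigenvectorBasis i
  have h2 : Module.End.HasEigenvalue (toLin' A) ((hH.eigenvalues i + l : ℝ) : ℂ) := by
    refine Module.End.hasEigenvalue_of_hasEigenvector (x := ⇑(hH.eigenvectorBasis i)) ⟨?_, ?_⟩
    · rw [Module.End.mem_eigenspace_iff, toLin'_apply]
      rw [sub_mulVec, smul_mulVec, one_mulVec, sub_eq_iff_eq_add] at h1
      rw [h1, Complex.ofReal_add, add_smul]
      rfl
    · intro h0
      have := hH.eigenvectorBasis.orthonormal.ne_zero i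
      exact this (by ext j; exact congrFun h0 j)
  have := hl.2 h2
  simpa using this

theorem IsHermitian.exists_isSmallestEigenvalue {d : ℕ}
    {A : Matrix (Fin (d + 1)) (Fin (d + 1)) ℂ} (hA : A.IsHermitian) :
    ∃ l, IsSmallestEigenvalue A l := by
  obtain ⟨i, -, hi⟩ := Finset.exists_min_image Finset.univ hA.eigenvalues Finset.univ_nonempty
  have hS : {t : ℝ | Module.End.HasEigenvalue (toLin' A) (t : ℂ)} = Set.range hA.eigenvalues := by
    rw [← hA.spectrum_real_eq_range_eigenvalues]
    ext t
    rw [Set.mem_ofPred_eq, Module.End.hasEigenvalue_iff_mem_spectrum, spectrum_toLin',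
      ← spectrum.algebraMap_mem_iff ℂ]
    rfl
  refine ⟨hA.eigenvalues i, ?_⟩
  rw [IsSmallestEigenvalue, hS]
  exact ⟨⟨i, rfl⟩, by rintro _ ⟨j, rfl⟩; exact hi j (Finset.mem_univ j)⟩

theorem PosDef.pos_of_isSmallestEigenvalue {A : Matrix (Fin m) (Fin m) ℂ} (hA : A.PosDef)
    {l : ℝ} (hl : IsSmallestEigenvalue A l) : 0 < l := by
  obtain ⟨v, hv⟩ := Module.End.HasEigenvalue.exists_hasEigenvector hl.1
  have h1 : A *ᵥ v = (l : ℂ) • v := by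
    have := Module.End.mem_eigenspace_iff.1 hv.1
    rwa [toLin'_apply] at this
  have h2 := hA.dotProduct_mulVec_pos hv.2
  rw [h1, dotProduct_smul, dotProduct_star_self_eq_sum_sq, smul_eq_mul, ← Complex.ofReal_mul,
    Complex.zero_lt_real] at h2
  have h3 : 0 ≤ ∑ i, ‖v i‖ ^ 2 := by positivity
  exact pos_of_mul_pos_left h2 h3

theorem PosDef.exists_eq_mul_conjTranspose {B : Matrix (Fin m) (Fin m) ℂ} (hB : B.PosDef) :
    ∃ S : Matrix (Fin m) (Fin m) ℂ, S.det ≠ 0 ∧ B = S * Sᴴ := by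
  have h0 : B.det ≠ 0 := hB.det_pos.ne'
  open scoped MatrixOrder in
  obtain ⟨R, hR⟩ := CStarAlgebra.nonneg_iff_eq_star_mul_self.mp hB.posSemidef.nonneg
  refine ⟨Rᴴ, fun h => h0 ?_, by rw [hR, conjTranspose_conjTranspose]; rfl⟩
  rw [hR, det_mul, star_eq_conjTranspose, h, zero_mul]

end Matrix

/-! ### The auxiliary function at one frequency -/

/-- The demixing matrix `[w  J]ᴴ` at a single frequency. -/
def demixAt {d : ℕ} (p : Fin (d + 1) → Fin (d + 1) → ℂ) : Matrix (Fin (d + 1)) (Fin (d + 1)) ℂ :=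
  Matrix.of fun i j => star (p i j)

/-- The background filters `J` at a single frequency. -/
def backgroundAt {d : ℕ} (p : Fin (d + 1) → Fin (d + 1) → ℂ) : Matrix (Fin (d + 1)) (Fin d) ℂ :=
  Matrix.of fun j i => p i.succ j

/-- The block matrix `diag (√l, S)`. -/
def blockScale {d : ℕ} (l : ℝ) (S : Matrix (Fin d) (Fin d) ℂ) :
    Matrix (Fin (d + 1)) (Fin (d + 1)) ℂ :=
  Matrix.of (Fin.cons (Fin.cons ((Real.sqrt l : ℝ) : ℂ) 0) fun i => Fin.cons 0 (S i))

theorem det_blockScale {d : ℕ} (l : ℝ) (S : Matrix (Fin d) (Fin d) ℂ) :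
    (blockScale l S).det = ((Real.sqrt l : ℝ) : ℂ) * S.det := by
  rw [Matrix.det_succ_row_zero, Fin.sum_univ_succ, Finset.sum_eq_zero]
  · have h : (blockScale l S).submatrix Fin.succ (Fin.succAbove 0) = S := by
      ext i j
      simp [blockScale]
    rw [h]
    simp [blockScale]
  · intro i _
    simp [blockScale]

/-- The filters `[w  J]` in whitened coordinates, with `w` scaled by `√l` and `J` multiplied
by `S`: the matrix `Q [w  J] diag (√l, S)`. -/
def whitenedFilters {d : ℕ} (Q : Matrix (Fin (d + 1)) (Fin (d + 1)) ℂ) (l : ℝ)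
    (S : Matrix (Fin d) (Fin d) ℂ) (p : Fin (d + 1) → Fin (d + 1) → ℂ) :
    Matrix (Fin (d + 1)) (Fin (d + 1)) ℂ :=
  Q * (demixAt p)ᴴ * blockScale l S

section

variable {d : ℕ} (Q : Matrix (Fin (d + 1)) (Fin (d + 1)) ℂ) (l : ℝ)
  (S : Matrix (Fin d) (Fin d) ℂ) (p : Fin (d + 1) → Fin (d + 1) → ℂ)

theorem whitenedFilters_zero (i : Fin (d + 1)) :
    whitenedFilters Q l S p i 0 = ((Real.sqrt l : ℝ) : ℂ) * (Q *ᵥ p 0) i := by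
  rw [whitenedFilters, Matrix.mul_apply, Fin.sum_univ_succ, Finset.sum_eq_zero]
  · simp [blockScale, demixAt, Matrix.mul_apply, Matrix.mulVec, dotProduct, mul_comm]
  · intro j _
    simp [blockScale]

theorem whitenedFilters_succ (i : Fin (d + 1)) (j : Fin d) :
    whitenedFilters Q l S p i j.succ = (Q * backgroundAt p * S) i j := by
  rw [whitenedFilters, Matrix.mul_apply, Fin.sum_univ_succ, Matrix.mul_apply]
  simp [blockScale, demixAt, backgroundAt, Matrix.mul_apply]

theorem sum_sq_whitenedFilters (hl : 0 ≤ l) :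
    ∑ j, ∑ i, ‖whitenedFilters Q l S p i j‖ ^ 2
      = l * (∑ i, ‖(Q *ᵥ p 0) i‖ ^ 2) + ∑ j, ∑ i, ‖(Q * backgroundAt p * S) i j‖ ^ 2 := by
  rw [Fin.sum_univ_succ]
  simp only [whitenedFilters_zero, whitenedFilters_succ, norm_mul, mul_pow, Complex.norm_real,
    Real.norm_eq_abs, sq_abs, Real.sq_sqrt hl, ← Finset.mul_sum]

theorem norm_det_whitenedFilters (hl : 0 ≤ l) :
    ‖(whitenedFilters Q l S p).det‖ ^ 2
      = ‖Q.det‖ ^ 2 * ‖(demixAt p).det‖ ^ 2 * (l * ‖S.det‖ ^ 2) := by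
  rw [whitenedFilters, Matrix.det_mul, Matrix.det_mul, Matrix.det_conjTranspose, det_blockScale]
  simp only [norm_mul, mul_pow, norm_star, Complex.norm_real, Real.norm_eq_abs, sq_abs,
    Real.sq_sqrt hl]

variable {Q l S p}

theorem log_norm_det_whitenedFilters (hQ : Q.det ≠ 0) (hl : 0 < l) (hS : S.det ≠ 0)
    (hp : (demixAt p).det ≠ 0) :
    Real.log (‖(whitenedFilters Q l S p).det‖ ^ 2)
      = 2 * Real.log ‖(demixAt p).det‖
        + (Real.log (‖Q.det‖ ^ 2) + Real.log l + Real.log (‖S.det‖ ^ 2)) := by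
  have h1 : ‖Q.det‖ ^ 2 ≠ 0 := by positivity
  have h2 : ‖(demixAt p).det‖ ^ 2 ≠ 0 := by positivity
  have h3 : ‖S.det‖ ^ 2 ≠ 0 := by positivity
  rw [norm_det_whitenedFilters Q l S p hl.le,
    Real.log_mul (mul_ne_zero h1 h2) (mul_ne_zero hl.ne' h3), Real.log_mul h1 h2,
    Real.log_mul hl.ne' h3, Real.log_pow ‖(demixAt p).det‖]
  push_cast
  ring

theorem det_whitenedFilters_ne_zero (hQ : Q.det ≠ 0) (hl : 0 < l) (hS : S.det ≠ 0)
    (hp : (demixAt p).det ≠ 0) : (whitenedFilters Q l S p).det ≠ 0 := by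
  intro h
  have h1 := norm_det_whitenedFilters Q l S p hl.le
  rw [h, norm_zero] at h1
  have : 0 < ‖Q.det‖ ^ 2 * ‖(demixAt p).det‖ ^ 2 * (l * ‖S.det‖ ^ 2) := by positivity
  rw [← h1] at this
  simp at this

/-- A Hadamard-type bound for the determinant of the demixing matrix: `log det H ≤ tr H - m` for the
Gram matrix `H` of the whitened filters. The scales `l` and `S` are free. -/
theorem log_norm_det_demixAt_le (hQ : Q.det ≠ 0) (hl : 0 < l) (hS : S.det ≠ 0)
    (hp : (demixAt p).det ≠ 0) :
    2 * Real.log ‖(demixAt p).det‖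
        + (Real.log (‖Q.det‖ ^ 2) + Real.log l + Real.log (‖S.det‖ ^ 2))
      ≤ l * (∑ i, ‖(Q *ᵥ p 0) i‖ ^ 2) + (∑ j, ∑ i, ‖(Q * backgroundAt p * S) i j‖ ^ 2)
        - (d + 1) := by
  have h := Matrix.log_norm_det_sq_le (det_whitenedFilters_ne_zero hQ hl hS hp)
  rw [log_norm_det_whitenedFilters hQ hl hS hp, sum_sq_whitenedFilters Q l S p hl.le] at h
  exact_mod_cast h

/-- Equality in `log_norm_det_demixAt_le` makes the whitened filters unitary; in particular their
first column has length `1`. -/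
theorem sum_sq_of_log_norm_det_demixAt (hQ : Q.det ≠ 0) (hl : 0 < l) (hS : S.det ≠ 0)
    (hp : (demixAt p).det ≠ 0)
    (h : l * (∑ i, ‖(Q *ᵥ p 0) i‖ ^ 2) + (∑ j, ∑ i, ‖(Q * backgroundAt p * S) i j‖ ^ 2) - (d + 1)
      ≤ 2 * Real.log ‖(demixAt p).det‖
        + (Real.log (‖Q.det‖ ^ 2) + Real.log l + Real.log (‖S.det‖ ^ 2))) :
    l * ∑ i, ‖(Q *ᵥ p 0) i‖ ^ 2 = 1 := by
  have h1 : (∑ j, ∑ i, ‖whitenedFilters Q l S p i j‖ ^ 2) - ((d + 1 : ℕ) : ℝ)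
      ≤ Real.log (‖(whitenedFilters Q l S p).det‖ ^ 2) := by
    rw [log_norm_det_whitenedFilters hQ hl hS hp, sum_sq_whitenedFilters Q l S p hl.le]
    exact_mod_cast h
  have h2 := Matrix.sum_sq_col_of_conjTranspose_mul_self
    (Matrix.conjTranspose_mul_self_eq_one_of_log_norm_det
      (det_whitenedFilters_ne_zero hQ hl hS hp) h1) 0
  simpa only [whitenedFilters_zero, norm_mul, mul_pow, Complex.norm_real, Real.norm_eq_abs, sq_abs,
    Real.sq_sqrt hl.le, ← Finset.mul_sum] using h2

end

/-- The summand of the auxiliary function that belongs to one frequency. -/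
def auxiliaryAt {d : ℕ} (V C : Matrix (Fin (d + 1)) (Fin (d + 1)) ℂ) (B : Matrix (Fin d) (Fin d) ℂ)
    (p : Fin (d + 1) → Fin (d + 1) → ℂ) : ℝ :=
  -2 * Real.log ‖(demixAt p).det‖ + (star (p 0) ⬝ᵥ (V *ᵥ p 0)).re
    + (Matrix.trace ((backgroundAt p)ᴴ * C * backgroundAt p * B⁻¹)).re

theorem re_trace_background {d : ℕ} {Q C : Matrix (Fin (d + 1)) (Fin (d + 1)) ℂ}
    {B S : Matrix (Fin d) (Fin d) ℂ} (hC : C = Qᴴ * Q) (hS : B⁻¹ = S * Sᴴ)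
    (J : Matrix (Fin (d + 1)) (Fin d) ℂ) :
    (Matrix.trace (Jᴴ * C * J * B⁻¹)).re = ∑ j, ∑ i, ‖(Q * J * S) i j‖ ^ 2 := by
  have h : Matrix.trace (Jᴴ * C * J * B⁻¹) = Matrix.trace ((Q * J * S)ᴴ * (Q * J * S)) := by
    rw [hC, hS, ← Matrix.mul_assoc, Matrix.trace_mul_comm]
    simp only [Matrix.conjTranspose_mul, Matrix.mul_assoc]
  rw [h, Matrix.trace_conjTranspose_mul_self_eq_sum_sq, Complex.ofReal_re]

/-- The minimal value of `auxiliaryAt`, when `l` is the smallest eigenvalue of the whitened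
weighted covariance matrix. -/
def auxiliaryFloor {d : ℕ} (Q : Matrix (Fin (d + 1)) (Fin (d + 1)) ℂ) (l : ℝ)
    (S : Matrix (Fin d) (Fin d) ℂ) : ℝ :=
  (d + 1) + (Real.log (‖Q.det‖ ^ 2) + Real.log l + Real.log (‖S.det‖ ^ 2))

section

variable {d : ℕ} {Q V C Vt : Matrix (Fin (d + 1)) (Fin (d + 1)) ℂ} {l : ℝ}
  {B S : Matrix (Fin d) (Fin d) ℂ} {p : Fin (d + 1) → Fin (d + 1) → ℂ}

theorem smallest_mul_le_quadratic (hVt : Vt.IsHermitian) (hl : IsSmallestEigenvalue Vt l)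
    (y : Fin (d + 1) → ℂ) : l * ∑ i, ‖y i‖ ^ 2 ≤ (star y ⬝ᵥ (Vt *ᵥ y)).re := by
  have h := (hVt.posSemidef_sub_smallest hl).re_dotProduct_nonneg y
  rw [Matrix.sub_mulVec, Matrix.smul_mulVec, Matrix.one_mulVec, dotProduct_sub, dotProduct_smul,
    Matrix.dotProduct_star_self_eq_sum_sq, smul_eq_mul, ← Complex.ofReal_mul] at h
  have h' : 0 ≤ (star y ⬝ᵥ (Vt *ᵥ y) - ((l * ∑ i, ‖y i‖ ^ 2 : ℝ) : ℂ)).re := h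
  rw [Complex.sub_re, Complex.ofReal_re] at h'
  linarith

theorem mulVec_eq_of_quadratic_le (hVt : Vt.IsHermitian) (hl : IsSmallestEigenvalue Vt l)
    {y : Fin (d + 1) → ℂ} (h : (star y ⬝ᵥ (Vt *ᵥ y)).re ≤ l * ∑ i, ‖y i‖ ^ 2) :
    Vt *ᵥ y = (l : ℂ) • y := by
  have hps := hVt.posSemidef_sub_smallest hl
  have h0 := hps.dotProduct_mulVec_nonneg y
  have h1 : star y ⬝ᵥ ((Vt - (l : ℂ) • (1 : Matrix _ _ ℂ)) *ᵥ y) = 0 := by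
    refine le_antisymm ?_ h0
    rw [Complex.le_def] at h0 ⊢
    refine ⟨?_, h0.2.symm⟩
    rw [Matrix.sub_mulVec, Matrix.smul_mulVec, Matrix.one_mulVec, dotProduct_sub, dotProduct_smul,
      Matrix.dotProduct_star_self_eq_sum_sq, smul_eq_mul, ← Complex.ofReal_mul, Complex.sub_re,
      Complex.ofReal_re, Complex.zero_re]
    linarith
  rw [hps.dotProduct_mulVec_zero_iff, Matrix.sub_mulVec, Matrix.smul_mulVec,
    Matrix.one_mulVec] at h1
  exact sub_eq_zero.1 h1

theorem auxiliaryFloor_le (hQ : Q.det ≠ 0) (hS : S.det ≠ 0) (hBS : B⁻¹ = S * Sᴴ)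
    (hC : C = Qᴴ * Q) (hV : ∀ y, star y ⬝ᵥ (V *ᵥ y) = star (Q *ᵥ y) ⬝ᵥ (Vt *ᵥ (Q *ᵥ y)))
    (hVt : Vt.IsHermitian) (hl : IsSmallestEigenvalue Vt l) (hl0 : 0 < l)
    (hp : (demixAt p).det ≠ 0) :
    auxiliaryFloor Q l S ≤ auxiliaryAt V C B p := by
  have h1 := log_norm_det_demixAt_le hQ hl0 hS hp
  have h2 := smallest_mul_le_quadratic hVt hl (Q *ᵥ p 0)
  rw [auxiliaryFloor, auxiliaryAt, re_trace_background hC hBS, hV]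
  linarith

/-- In a minimizer of the auxiliary function, the target filter is an eigenvector for the smallest
eigenvalue `l`, scaled to the length `1 / √l`. -/
theorem eigenvector_of_auxiliaryAt_le (hQ : Q.det ≠ 0) (hS : S.det ≠ 0) (hBS : B⁻¹ = S * Sᴴ)
    (hC : C = Qᴴ * Q) (hV : ∀ y, star y ⬝ᵥ (V *ᵥ y) = star (Q *ᵥ y) ⬝ᵥ (Vt *ᵥ (Q *ᵥ y)))
    (hVt : Vt.IsHermitian) (hl : IsSmallestEigenvalue Vt l) (hl0 : 0 < l)
    (hp : (demixAt p).det ≠ 0) (hmin : auxiliaryAt V C B p ≤ auxiliaryFloor Q l S) :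
    Vt *ᵥ (Q *ᵥ p 0) = (l : ℂ) • (Q *ᵥ p 0) ∧ l * ∑ i, ‖(Q *ᵥ p 0) i‖ ^ 2 = 1 := by
  have h1 := log_norm_det_demixAt_le hQ hl0 hS hp
  have h2 := smallest_mul_le_quadratic hVt hl (Q *ᵥ p 0)
  rw [auxiliaryFloor, auxiliaryAt, re_trace_background hC hBS, hV] at hmin
  exact ⟨mulVec_eq_of_quadratic_le hVt hl (by linarith),
    sum_sq_of_log_norm_det_demixAt hQ hl0 hS hp (by linarith)⟩

/-- Completing a unit eigenvector to a unitary matrix yields background filters for which the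
lower bound `auxiliaryFloor` is attained. -/
theorem exists_auxiliaryAt_eq_floor (hQ : Q.det ≠ 0) (hS : S.det ≠ 0) (hBS : B⁻¹ = S * Sᴴ)
    (hC : C = Qᴴ * Q) (hV : ∀ y, star y ⬝ᵥ (V *ᵥ y) = star (Q *ᵥ y) ⬝ᵥ (Vt *ᵥ (Q *ᵥ y)))
    (hl0 : 0 < l) {v : Fin (d + 1) → ℂ} (hv : Vt *ᵥ v = (l : ℂ) • v) (hv1 : star v ⬝ᵥ v = 1) :
    ∃ p : Fin (d + 1) → Fin (d + 1) → ℂ, p 0 = Q⁻¹ *ᵥ ((((Real.sqrt l)⁻¹ : ℝ) : ℂ) • v) ∧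
      (demixAt p).det ≠ 0 ∧ auxiliaryAt V C B p = auxiliaryFloor Q l S := by
  obtain ⟨A, hA, hA0⟩ := Matrix.exists_unitary_first_column hv1
  have hs : ((Real.sqrt l : ℝ) : ℂ) ≠ 0 := by
    exact_mod_cast (Real.sqrt_pos.2 hl0).ne'
  have hE : IsUnit (blockScale l S).det := by
    rw [det_blockScale]
    exact isUnit_iff_ne_zero.2 (mul_ne_zero hs hS)
  have hQ' : IsUnit Q.det := isUnit_iff_ne_zero.2 hQ
  set p : Fin (d + 1) → Fin (d + 1) → ℂ :=
    fun i j => (Q⁻¹ * A * (blockScale l S)⁻¹) j i with hpdef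
  have hP : (demixAt p)ᴴ = Q⁻¹ * A * (blockScale l S)⁻¹ := by
    ext i j
    simp [demixAt, hpdef]
  have hW : whitenedFilters Q l S p = A := by
    rw [whitenedFilters, hP, Matrix.mul_assoc Q⁻¹, Matrix.mul_nonsing_inv_cancel_left _ _ hQ',
      Matrix.nonsing_inv_mul_cancel_right _ _ hE]
  have hp : (demixAt p).det ≠ 0 := by
    intro h
    have h1 := norm_det_whitenedFilters Q l S p hl0.le
    rw [hW, Matrix.norm_det_sq_of_conjTranspose_mul_self hA, h] at h1
    simp at h1
  have hu : Q *ᵥ p 0 = (((Real.sqrt l)⁻¹ : ℝ) : ℂ) • v := by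
    ext i
    have h := whitenedFilters_zero Q l S p i
    rw [hW, hA0] at h
    rw [Pi.smul_apply, smul_eq_mul, h, Complex.ofReal_inv, inv_mul_cancel_left₀ hs]
  have hlog := log_norm_det_whitenedFilters hQ hl0 hS hp
  rw [hW, Matrix.norm_det_sq_of_conjTranspose_mul_self hA, Real.log_one] at hlog
  have hsum := sum_sq_whitenedFilters Q l S p hl0.le
  rw [hW] at hsum
  simp only [Matrix.sum_sq_col_of_conjTranspose_mul_self hA, Finset.sum_const, Finset.card_univ,
    Fintype.card_fin, nsmul_eq_mul, mul_one] at hsum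
  have hquad : (star (p 0) ⬝ᵥ (V *ᵥ p 0)).re = l * ∑ i, ‖(Q *ᵥ p 0) i‖ ^ 2 := by
    have h : Vt *ᵥ (Q *ᵥ p 0) = (l : ℂ) • (Q *ᵥ p 0) := by
      rw [hu, Matrix.mulVec_smul, hv, smul_comm]
    rw [hV, h, dotProduct_smul, Matrix.dotProduct_star_self_eq_sum_sq, smul_eq_mul,
      ← Complex.ofReal_mul, Complex.ofReal_re]
  refine ⟨p, ?_, hp, ?_⟩
  · rw [← hu, Matrix.mulVec_mulVec, Matrix.nonsing_inv_mul _ hQ', Matrix.one_mulVec]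
  · rw [auxiliaryFloor, auxiliaryAt, re_trace_background hC hBS, hquad]
    push_cast at hsum
    linarith

end

/-! ### Quadratic forms of the covariance matrices -/

section Covariance

variable {N F d : ℕ}

theorem star_dotProduct_weightedCov (φ : Fin N → ℝ → ℝ) (r : Fin N → ℝ) (x : Data N F d)
    (f : Fin F) (y : Fin (d + 1) → ℂ) :
    star y ⬝ᵥ (weightedCov φ r x f *ᵥ y)
      = (((1 / N : ℝ) * ∑ n, φ n (r n) * ‖star y ⬝ᵥ x n f‖ ^ 2 : ℝ) : ℂ) := by
  have h : ∀ a : Fin (d + 1) → ℂ, star y ⬝ᵥ (Matrix.vecMulVec a (star a) *ᵥ y)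
      = ((‖star y ⬝ᵥ a‖ ^ 2 : ℝ) : ℂ) := fun a => by
    rw [Matrix.vecMulVec_mulVec, dotProduct_smul, Matrix.star_dotProduct a y, op_smul_eq_mul,
      RCLike.star_def, Complex.mul_conj', Complex.ofReal_pow]
  rw [weightedCov, Matrix.smul_mulVec, Matrix.sum_mulVec, dotProduct_smul, dotProduct_sum]
  simp only [Matrix.smul_mulVec, dotProduct_smul, h, smul_eq_mul]
  push_cast
  rfl

theorem sampleCov_eq_weightedCov (x : Data N F d) (f : Fin F) :
    sampleCov x f = weightedCov (fun _ _ => 1) (fun _ => 0) x f := by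
  simp [sampleCov, weightedCov]

theorem isHermitian_weightedCov (φ : Fin N → ℝ → ℝ) (r : Fin N → ℝ) (x : Data N F d)
    (f : Fin F) : (weightedCov φ r x f).IsHermitian := by
  simp only [Matrix.IsHermitian, weightedCov, Matrix.conjTranspose_smul,
    Matrix.conjTranspose_sum, Matrix.conjTranspose_vecMulVec, star_star]
  simp

variable {x : Data N F d} {Q : Fin F → Matrix (Fin (d + 1)) (Fin (d + 1)) ℂ}

theorem star_mulVec_dotProduct_whiten {f : Fin F} (hQ : IsUnit (Q f).det) (n : Fin N)
    (y : Fin (d + 1) → ℂ) : star (Q f *ᵥ y) ⬝ᵥ whiten Q x n f = star y ⬝ᵥ x n f := by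
  have h : IsUnit ((Q f)ᴴ).det := by
    rw [Matrix.det_conjTranspose]
    exact hQ.star
  rw [whiten, Matrix.star_mulVec, ← Matrix.dotProduct_mulVec, Matrix.mulVec_mulVec,
    Matrix.mul_nonsing_inv _ h, Matrix.one_mulVec]

/-- Whitening conjugates the weighted covariance matrix: `V_f = Q_fᴴ Ṽ_f Q_f`. -/
theorem star_dotProduct_weightedCov_whiten {f : Fin F} (hQ : IsUnit (Q f).det)
    (φ : Fin N → ℝ → ℝ) (r : Fin N → ℝ) (y : Fin (d + 1) → ℂ) :
    star y ⬝ᵥ (weightedCov φ r x f *ᵥ y)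
      = star (Q f *ᵥ y) ⬝ᵥ (weightedCov φ r (whiten Q x) f *ᵥ (Q f *ᵥ y)) := by
  simp only [star_dotProduct_weightedCov, star_mulVec_dotProduct_whiten hQ]

/-- In whitened coordinates the sample covariance is the identity. -/
theorem sum_sq_mulVec_eq {f : Fin F} (hxQ : sampleCov x f = (Q f)ᴴ * Q f)
    (y : Fin (d + 1) → ℂ) :
    ∑ i, ‖(Q f *ᵥ y) i‖ ^ 2 = (1 / N : ℝ) * ∑ n, ‖star y ⬝ᵥ x n f‖ ^ 2 := by
  have h1 : star y ⬝ᵥ (sampleCov x f *ᵥ y) = ((∑ i, ‖(Q f *ᵥ y) i‖ ^ 2 : ℝ) : ℂ) := by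
    rw [hxQ, ← Matrix.dotProduct_star_self_eq_sum_sq, ← Matrix.mulVec_mulVec,
      Matrix.dotProduct_mulVec, ← Matrix.star_mulVec]
  rw [sampleCov_eq_weightedCov, star_dotProduct_weightedCov] at h1
  simpa using (Complex.ofReal_injective h1).symm

/-- An invertible sample covariance matrix at some frequency requires at least one frame. -/
theorem frames_pos (hQ : ∀ f, IsUnit (Q f).det) (hxQ : ∀ f, sampleCov x f = (Q f)ᴴ * Q f)
    (f : Fin F) : 0 < N := by
  rcases Nat.eq_zero_or_pos N with h | h
  · subst h
    have h0 : ((Q f)ᴴ * Q f).det = 0 := by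
      rw [← hxQ]
      simp [sampleCov]
    rw [Matrix.det_mul, Matrix.det_conjTranspose] at h0
    exact absurd h0 (mul_ne_zero (hQ f).star.ne_zero (hQ f).ne_zero)
  · exact h

/-- If the quadratic form of the weighted covariance vanishes at `y`, then so does that of the
sample covariance, as all the weights are positive. -/
theorem posDef_weightedCov_whiten {f : Fin F} (hQ : IsUnit (Q f).det)
    (hxQ : sampleCov x f = (Q f)ᴴ * Q f) (φ : Fin N → ℝ → ℝ) (r : Fin N → ℝ)
    (hφ : ∀ n, 0 < φ n (r n)) : (weightedCov φ r (whiten Q x) f).PosDef := by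
  refine Matrix.PosDef.of_dotProduct_mulVec_pos (isHermitian_weightedCov _ _ _ _) fun y hy => ?_
  obtain ⟨y, rfl⟩ : ∃ z, y = Q f *ᵥ z :=
    ⟨(Q f)⁻¹ *ᵥ y, by rw [Matrix.mulVec_mulVec, Matrix.mul_nonsing_inv _ hQ, Matrix.one_mulVec]⟩
  rw [← star_dotProduct_weightedCov_whiten hQ, star_dotProduct_weightedCov, Complex.zero_lt_real]
  have h1 : 0 < ∑ i, ‖(Q f *ᵥ y) i‖ ^ 2 := by
    obtain ⟨i, hi⟩ := Function.ne_iff.1 hy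
    exact Finset.sum_pos' (fun i _ => by positivity)
      ⟨i, Finset.mem_univ i, pow_pos (norm_pos_iff.2 hi) 2⟩
  rw [sum_sq_mulVec_eq hxQ] at h1
  have hN : (0 : ℝ) ≤ 1 / N := by positivity
  have hN' : (0 : ℝ) < 1 / N := lt_of_le_of_ne hN fun h => by simp [← h] at h1
  have h2 := (mul_pos_iff_of_pos_left hN').1 h1
  refine mul_pos hN' ?_
  obtain ⟨n, hn, hpos⟩ := Finset.exists_lt_of_sum_lt (s := Finset.univ)
    (f := fun _ : Fin N => (0 : ℝ)) (by simpa using h2)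
  exact Finset.sum_pos' (fun n _ => mul_nonneg (hφ n).le (by positivity))
    ⟨n, hn, mul_pos (hφ n) hpos⟩

end Covariance

/-! ### The negative log-likelihood and its majorization -/

section Likelihood

variable {N F d : ℕ} {G : Fin N → ℝ → ℝ} {B : Fin F → Matrix (Fin d) (Fin d) ℂ}

theorem demix_eq_demixAt (θ : Filters F d) (f : Fin F) : demix θ f = demixAt (θ f) := rfl

theorem auxiliary_eq (G : Fin N → ℝ → ℝ) (B : Fin F → Matrix (Fin d) (Fin d) ℂ) (x : Data N F d)
    (r : Fin N → ℝ) (θ : Filters F d) :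
    auxiliary G B x r θ
      = N * ∑ f, auxiliaryAt (weightedCov (fun n => weight (G n)) r x f) (sampleCov x f) (B f) (θ f)
        + (∑ n, (G n (r n) - weight (G n) (r n) * r n ^ 2) + normalization G B) := by
  have h : ∀ f, backgroundAt (θ f) = backgroundFilter θ f := fun _ => rfl
  simp only [auxiliary, auxiliaryAt, demix_eq_demixAt, Finset.sum_add_distrib, ← Finset.mul_sum, h]
  ring

theorem background_eq (θ : Filters F d) (x : Data N F d) (n : Fin N) (f : Fin F) :
    background θ x n f = (backgroundFilter θ f)ᴴ *ᵥ x n f := by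
  ext i
  simp [background, backgroundFilter, Matrix.mulVec, dotProduct, Matrix.conjTranspose_apply]

theorem trace_background (x : Data N F d) (θ : Filters F d) (f : Fin F)
    (K : Matrix (Fin d) (Fin d) ℂ) :
    N * (Matrix.trace ((backgroundFilter θ f)ᴴ * sampleCov x f * backgroundFilter θ f * K)).re
      = ∑ n, (star (background θ x n f) ⬝ᵥ (K *ᵥ background θ x n f)).re := by
  have h : ∀ n, Matrix.trace ((backgroundFilter θ f)ᴴ * Matrix.vecMulVec (x n f) (star (x n f))
        * backgroundFilter θ f * K)
      = star (background θ x n f) ⬝ᵥ (K *ᵥ background θ x n f) := fun n => by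
    rw [Matrix.mul_vecMulVec, Matrix.vecMulVec_mul, Matrix.vecMulVec_mul, Matrix.trace_vecMulVec,
      background_eq, Matrix.star_mulVec, Matrix.conjTranspose_conjTranspose,
      Matrix.dotProduct_mulVec, dotProduct_comm]
  rcases Nat.eq_zero_or_pos N with h0 | h0
  · subst h0
    simp
  · have hN : (N : ℂ) ≠ 0 := by exact_mod_cast h0.ne'
    rw [sampleCov, Matrix.mul_smul, Matrix.smul_mul, Matrix.smul_mul, Matrix.trace_smul,
      Matrix.mul_sum, Matrix.sum_mul, Matrix.sum_mul, Matrix.trace_sum, smul_eq_mul]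
    simp only [h]
    rw [← Complex.re_sum]
    have : ∀ z : ℂ, (N : ℝ) * (1 / (N : ℂ) * z).re = z.re := fun z => by
      rw [← Complex.re_ofReal_mul, Complex.ofReal_natCast, ← mul_assoc, mul_one_div_cancel hN,
        one_mul]
    exact this _

theorem sourceMass_pos {g : ℝ → ℝ}
    (hint : Integrable (fun s : Fin F → ℂ => Real.exp (-g (activity s)))) :
    0 < sourceMass F g :=
  integral_exp_pos hint

/-- The negative log-likelihood in closed form. At degenerate `θ` the likelihood vanishes, and
its logarithm is a junk value. -/
theorem negLogLik_eq (hint : ∀ n, Integrable (fun s : Fin F → ℂ => Real.exp (-G n (activity s))))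
    (hB : ∀ f, (B f).PosDef) (x : Data N F d) {θ : Filters F d} (hθ : Nondegenerate θ) :
    negLogLik G B x θ
      = -2 * N * ∑ f, Real.log ‖(demix θ f).det‖ + ∑ n, G n (activity (target θ x n))
        + N * ∑ f, (Matrix.trace
            ((backgroundFilter θ f)ᴴ * sampleCov x f * backgroundFilter θ f * (B f)⁻¹)).re
        + normalization G B := by
  have hm : ∀ n, 0 < sourceMass F (G n) := fun n => sourceMass_pos (hint n)
  have hs : ∀ n, 0 < sourceDensity (G n) (target θ x n) := fun n =>
    mul_pos (inv_pos.2 (hm n)) (Real.exp_pos _)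
  have hdet : ∀ f, 0 < ‖(demix θ f).det‖ := fun f => norm_pos_iff.2 (hθ f)
  have hBd : ∀ f, 0 < Real.pi ^ d * ‖(B f).det‖ := fun f =>
    mul_pos (pow_pos Real.pi_pos d) (norm_pos_iff.2 (hB f).det_pos.ne')
  have hg : ∀ n f, 0 < gaussianDensity (B f) (background θ x n f) := fun n f =>
    mul_pos (inv_pos.2 (hBd f)) (Real.exp_pos _)
  have hgl : ∀ n f, Real.log (‖(demix θ f).det‖ ^ 2 * gaussianDensity (B f) (background θ x n f))
      = 2 * Real.log ‖(demix θ f).det‖ - Real.log (Real.pi ^ d * ‖(B f).det‖)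
        - (star (background θ x n f) ⬝ᵥ ((B f)⁻¹ *ᵥ background θ x n f)).re := fun n f => by
    rw [Real.log_mul (pow_pos (hdet f) 2).ne' (hg n f).ne', Real.log_pow, gaussianDensity,
      Real.log_mul (inv_pos.2 (hBd f)).ne' (Real.exp_pos _).ne', Real.log_inv, Real.log_exp]
    push_cast
    ring
  have hsl : ∀ n, Real.log (sourceDensity (G n) (target θ x n))
      = -Real.log (sourceMass F (G n)) - G n (activity (target θ x n)) := fun n => by
    rw [sourceDensity, Real.log_mul (inv_pos.2 (hm n)).ne' (Real.exp_pos _).ne', Real.log_inv,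
      Real.log_exp]
    ring
  have hp : ∀ n, 0 < ∏ f, (‖(demix θ f).det‖ ^ 2 * gaussianDensity (B f) (background θ x n f)) :=
    fun n => Finset.prod_pos fun f _ => mul_pos (pow_pos (hdet f) 2) (hg n f)
  have hlik : Real.log (likelihood G B x θ)
      = ∑ n, ((-Real.log (sourceMass F (G n)) - G n (activity (target θ x n)))
        + ∑ f, (2 * Real.log ‖(demix θ f).det‖ - Real.log (Real.pi ^ d * ‖(B f).det‖)
          - (star (background θ x n f) ⬝ᵥ ((B f)⁻¹ *ᵥ background θ x n f)).re)) := by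
    rw [likelihood, Real.log_prod fun n _ => (mul_pos (hs n) (hp n)).ne']
    refine Finset.sum_congr rfl fun n _ => ?_
    rw [Real.log_mul (hs n).ne' (hp n).ne', hsl, Real.log_prod fun f _ =>
      (mul_pos (pow_pos (hdet f) 2) (hg n f)).ne']
    simp only [hgl]
  have htr : N * ∑ f, (Matrix.trace
      ((backgroundFilter θ f)ᴴ * sampleCov x f * backgroundFilter θ f * (B f)⁻¹)).re
      = ∑ n, ∑ f, (star (background θ x n f) ⬝ᵥ ((B f)⁻¹ *ᵥ background θ x n f)).re := by
    rw [Finset.mul_sum, Finset.sum_comm]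
    exact Finset.sum_congr rfl fun f _ => trace_background x θ f _
  rw [negLogLik, hlik, normalization, htr]
  simp only [Finset.sum_add_distrib, Finset.sum_sub_distrib, Finset.sum_neg_distrib,
    Finset.sum_const, Finset.card_univ, Fintype.card_fin, nsmul_eq_mul, ← Finset.mul_sum]
  ring

theorem activity_nonneg (s : Fin F → ℂ) : 0 ≤ activity s := Real.sqrt_nonneg _

theorem activity_sq (s : Fin F → ℂ) : activity s ^ 2 = ∑ f, ‖s f‖ ^ 2 :=
  Real.sq_sqrt (Finset.sum_nonneg fun f _ => by positivity)

theorem quadratic_weightedCov (x : Data N F d) (φ : Fin N → ℝ → ℝ) (r : Fin N → ℝ)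
    (θ : Filters F d) :
    N * ∑ f, (star (θ f 0) ⬝ᵥ (weightedCov φ r x f *ᵥ θ f 0)).re
      = ∑ n, φ n (r n) * activity (target θ x n) ^ 2 := by
  simp only [star_dotProduct_weightedCov, Complex.ofReal_re, activity_sq, target, ← Finset.mul_sum]
  rw [Finset.sum_comm]
  simp only [Finset.mul_sum, ← mul_assoc]
  rcases Nat.eq_zero_or_pos N with h0 | h0
  · subst h0
    simp
  · have hN : (N : ℝ) ≠ 0 := by exact_mod_cast h0.ne'
    simp only [mul_one_div_cancel hN, one_mul]

/-- The gap between the auxiliary function and the negative log-likelihood is the sum of the gaps in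
the tangent bounds for the `G n`. -/
theorem auxiliary_sub_negLogLik
    (hint : ∀ n, Integrable (fun s : Fin F → ℂ => Real.exp (-G n (activity s))))
    (hB : ∀ f, (B f).PosDef) (x : Data N F d) (r : Fin N → ℝ) {θ : Filters F d}
    (hθ : Nondegenerate θ) :
    auxiliary G B x r θ - negLogLik G B x θ
      = ∑ n, (G n (r n) + weight (G n) (r n) * (activity (target θ x n) ^ 2 - r n ^ 2)
        - G n (activity (target θ x n))) := by
  rw [negLogLik_eq hint hB x hθ, auxiliary, quadratic_weightedCov]
  simp only [mul_sub, Finset.sum_sub_distrib, Finset.sum_add_distrib]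
  ring

theorem negLogLik_le_auxiliary (hG : ∀ n, IsSuperGaussian (G n))
    (hint : ∀ n, Integrable (fun s : Fin F → ℂ => Real.exp (-G n (activity s))))
    (hB : ∀ f, (B f).PosDef) (x : Data N F d) {r : Fin N → ℝ}
    (hr : ∀ n, WeightDefined (G n) (r n)) {θ : Filters F d} (hθ : Nondegenerate θ) :
    negLogLik G B x θ ≤ auxiliary G B x r θ := by
  rw [← sub_nonneg, auxiliary_sub_negLogLik hint hB x r hθ]
  exact Finset.sum_nonneg fun n _ =>
    sub_nonneg.2 ((hG n).le_tangent (hr n) (activity_nonneg _))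

theorem negLogLik_eq_auxiliary
    (hint : ∀ n, Integrable (fun s : Fin F → ℂ => Real.exp (-G n (activity s))))
    (hB : ∀ f, (B f).PosDef) (x : Data N F d) {θ : Filters F d} (hθ : Nondegenerate θ) :
    negLogLik G B x θ = auxiliary G B x (fun n => activity (target θ x n)) θ := by
  rw [eq_comm, ← sub_eq_zero, auxiliary_sub_negLogLik hint hB x _ hθ]
  simp

end Likelihood

/-! ### The law of the mixture -/

/-- Tonelli's theorem for a product of functions of separate variables. -/
theorem lintegral_pi_prod {X : Type*} [MeasurableSpace X] {n : ℕ} (μ : Fin n → Measure X)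
    [∀ i, SigmaFinite (μ i)] {h : Fin n → X → ENNReal} (hh : ∀ i, Measurable (h i)) :
    ∫⁻ x, ∏ i, h i (x i) ∂Measure.pi μ = ∏ i, ∫⁻ y, h i y ∂μ i := by
  induction n with
  | zero => simp
  | succ n ih =>
    have hmp := (measurePreserving_piFinSuccAbove μ 0).symm
    rw [← hmp.lintegral_comp (by fun_prop), Fin.prod_univ_succ, ← ih _ fun i => hh i.succ,
      ← lintegral_prod_mul (hh 0).aemeasurable
        (Finset.measurable_prod _ fun i _ =>
          (hh i.succ).comp (measurable_pi_apply i)).aemeasurable]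
    refine lintegral_congr fun z => ?_
    rw [Fin.prod_univ_succ]
    simp [MeasurableEquiv.piFinSuccAbove, Fin.insertNthEquiv]

theorem pi_withDensity {X : Type*} [MeasurableSpace X] {n : ℕ} (μ : Fin n → Measure X)
    [∀ i, SigmaFinite (μ i)] {h : Fin n → X → ENNReal} (hh : ∀ i, Measurable (h i))
    [∀ i, SigmaFinite ((μ i).withDensity (h i))] :
    Measure.pi (fun i => (μ i).withDensity (h i))
      = (Measure.pi μ).withDensity fun x => ∏ i, h i (x i) := by
  refine Measure.pi_eq fun s hs => ?_
  rw [withDensity_apply _ (MeasurableSet.univ_pi hs), Measure.restrict_pi_pi,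
    lintegral_pi_prod _ hh]
  exact Finset.prod_congr rfl fun i _ => (withDensity_apply _ (hs i)).symm

/-- A density that factors through `T` is pushed forward to its factor. -/
theorem map_withDensity_comp {X Y : Type*} [MeasurableSpace X] [MeasurableSpace Y] (μ : Measure X)
    {T : X → Y} (hT : Measurable T) {g : Y → ENNReal} (hg : Measurable g) :
    (μ.withDensity fun a => g (T a)).map T = (μ.map T).withDensity g := by
  ext s hs
  rw [Measure.map_apply hT hs, withDensity_apply _ (hT hs), withDensity_apply _ hs,
    setLIntegral_map hs hg hT]

/-- As a real linear map, a complex matrix scales the volume by the square of the modulus of its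
determinant. -/
theorem map_mulVec_volume {m : ℕ} {A : Matrix (Fin m) (Fin m) ℂ} (hA : A.det ≠ 0) :
    (volume : Measure (Fin m → ℂ)).map (fun y => A *ᵥ y)
      = (volume : Measure (Fin m → ℂ)).withDensity fun _ => ENNReal.ofReal ((‖A.det‖ ^ 2)⁻¹) := by
  have hdet : LinearMap.det ((Matrix.toLin' A).restrictScalars ℝ) = ‖A.det‖ ^ 2 := by
    rw [LinearMap.det_restrictScalars, LinearMap.det_toLin', Algebra.norm_complex_apply,
      Complex.normSq_eq_norm_sq]
  have h := Measure.map_linearMap_addHaar_eq_smul_addHaar (volume : Measure (Fin m → ℂ))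
    (f := (Matrix.toLin' A).restrictScalars ℝ) (by rw [hdet]; positivity)
  rw [withDensity_const, ← abs_of_nonneg (inv_nonneg.2 (sq_nonneg ‖A.det‖)), ← hdet, ← h]
  rfl

section

variable {N F d : ℕ}

/-- Interleaving target and background into multichannel data preserves the volume. -/
theorem measurePreserving_cons :
    MeasurePreserving (fun (y : (Fin N → Fin F → ℂ) × (Fin N → Fin F → Fin d → ℂ)) n f =>
      (Fin.cons (y.1 n f) (y.2 n f) : Fin (d + 1) → ℂ)) := by
  have h1 : MeasurePreserving
      (fun y : ℂ × (Fin d → ℂ) => (Fin.cons y.1 y.2 : Fin (d + 1) → ℂ)) := by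
    have h := (volume_preserving_piFinSuccAbove (fun _ : Fin (d + 1) => ℂ) 0).symm
    convert h using 1
    ext y
    simp [MeasurableEquiv.piFinSuccAbove, Fin.insertNthEquiv]
  have h2 : MeasurePreserving (fun (y : Fin F → ℂ × (Fin d → ℂ)) f =>
      (Fin.cons (y f).1 (y f).2 : Fin (d + 1) → ℂ)) := volume_preserving_pi fun _ => h1
  have h3 := h2.comp (volume_measurePreserving_arrowProdEquivProdArrow ℂ (Fin d → ℂ) (Fin F)).symm
  have h4 : MeasurePreserving (fun (y : Fin N → (Fin F → ℂ) × (Fin F → Fin d → ℂ)) n f =>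
      (Fin.cons ((y n).1 f) ((y n).2 f) : Fin (d + 1) → ℂ)) := volume_preserving_pi fun _ => h3
  exact h4.comp (volume_measurePreserving_arrowProdEquivProdArrow (Fin F → ℂ)
    (Fin F → Fin d → ℂ) (Fin N)).symm

theorem map_demix_volume {θ : Filters F d} (hθ : Nondegenerate θ) :
    (volume : Measure (Data N F d)).map (fun a n f => (demix θ f)⁻¹ *ᵥ a n f)
      = (volume : Measure (Data N F d)).withDensity
          fun _ => ENNReal.ofReal (∏ _n : Fin N, ∏ f, ‖(demix θ f).det‖ ^ 2) := by
  have h1 : ∀ f, (volume : Measure (Fin (d + 1) → ℂ)).map (fun y => (demix θ f)⁻¹ *ᵥ y)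
      = volume.withDensity fun _ => ENNReal.ofReal (‖(demix θ f).det‖ ^ 2) := fun f => by
    have h0 : ((demix θ f)⁻¹).det ≠ 0 := by
      rw [Matrix.det_nonsing_inv, Ring.inverse_eq_inv']
      exact inv_ne_zero (hθ f)
    rw [map_mulVec_volume h0, Matrix.det_nonsing_inv, Ring.inverse_eq_inv', norm_inv, inv_pow,
      inv_inv]
  have hs : ∀ f, SigmaFinite
      ((volume : Measure (Fin (d + 1) → ℂ)).map (fun y => (demix θ f)⁻¹ *ᵥ y)) := fun f => by
    rw [h1]
    exact SigmaFinite.withDensity_ofReal _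
  have h2 : (volume : Measure (Fin F → Fin (d + 1) → ℂ)).map
      (fun a f => (demix θ f)⁻¹ *ᵥ a f)
      = volume.withDensity fun _ => ENNReal.ofReal (∏ f, ‖(demix θ f).det‖ ^ 2) := by
    have hm : ∀ f, Measurable fun y => (demix θ f)⁻¹ *ᵥ y := fun f =>
      (Continuous.matrix_mulVec continuous_const continuous_id).measurable
    have hsig : ∀ f, SigmaFinite ((volume : Measure (Fin (d + 1) → ℂ)).withDensity
        fun _ => ENNReal.ofReal (‖(demix θ f).det‖ ^ 2)) := fun f =>
      SigmaFinite.withDensity_ofReal _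
    rw [volume_pi, Measure.pi_map_pi fun f => (hm f).aemeasurable]
    simp only [h1]
    rw [pi_withDensity _ fun f => measurable_const]
    simp only [ENNReal.ofReal_prod_of_nonneg fun f _ => sq_nonneg ‖(demix θ f).det‖]
  have hm : Measurable fun (a : Fin F → Fin (d + 1) → ℂ) f => (demix θ f)⁻¹ *ᵥ a f :=
    (continuous_pi fun f =>
      Continuous.matrix_mulVec continuous_const (continuous_apply f)).measurable
  have hsig : SigmaFinite ((volume : Measure (Fin F → Fin (d + 1) → ℂ)).withDensity
      fun _ => ENNReal.ofReal (∏ f, ‖(demix θ f).det‖ ^ 2)) := SigmaFinite.withDensity_ofReal _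
  have hsig' : SigmaFinite ((volume : Measure (Fin F → Fin (d + 1) → ℂ)).map
      (fun a f => (demix θ f)⁻¹ *ᵥ a f)) := by rwa [h2]
  rw [volume_pi, Measure.pi_map_pi fun n => hm.aemeasurable]
  simp only [h2]
  rw [pi_withDensity _ fun n => measurable_const]
  simp only [ENNReal.ofReal_prod_of_nonneg fun _ _ =>
    Finset.prod_nonneg fun f _ => sq_nonneg ‖(demix θ f).det‖]

theorem continuous_activity : Continuous (activity : (Fin F → ℂ) → ℝ) := by
  unfold activity
  fun_prop

theorem measurable_sourceDensity {g : ℝ → ℝ} (hg : IsSuperGaussian g) :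
    Measurable (sourceDensity g : (Fin F → ℂ) → ℝ) := by
  have h : Continuous fun s : Fin F → ℂ => g (activity s) :=
    hg.continuous.comp_continuous continuous_activity activity_nonneg
  unfold sourceDensity
  exact (continuous_const.mul (Real.continuous_exp.comp h.neg)).measurable

theorem measurable_gaussianDensity (B : Matrix (Fin d) (Fin d) ℂ) :
    Measurable (gaussianDensity B) := by
  have h : Continuous fun z : Fin d → ℂ => (star z ⬝ᵥ (B⁻¹ *ᵥ z)).re :=
    Complex.continuous_re.comp
      (continuous_star.dotProduct (Continuous.matrix_mulVec continuous_const continuous_id))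
  unfold gaussianDensity
  exact (continuous_const.mul (Real.continuous_exp.comp h.neg)).measurable

theorem sourceLaw_eq {G : Fin N → ℝ → ℝ} (hG : ∀ n, IsSuperGaussian (G n)) :
    sourceLaw F G = (volume : Measure (Fin N → Fin F → ℂ)).withDensity
      fun s => ∏ n, ENNReal.ofReal (sourceDensity (G n) (s n)) := by
  have hsig : ∀ n, SigmaFinite ((volume : Measure (Fin F → ℂ)).withDensity
      fun s => ENNReal.ofReal (sourceDensity (G n) s)) := fun n => SigmaFinite.withDensity_ofReal _
  rw [sourceLaw, pi_withDensity _ fun n => (measurable_sourceDensity (hG n)).ennreal_ofReal]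
  rfl

theorem gaussianDensity_nonneg (B : Matrix (Fin d) (Fin d) ℂ) (z : Fin d → ℂ) :
    0 ≤ gaussianDensity B z := by
  unfold gaussianDensity
  positivity

theorem sourceDensity_nonneg (g : ℝ → ℝ) (s : Fin F → ℂ) : 0 ≤ sourceDensity g s :=
  mul_nonneg (inv_nonneg.2 (integral_nonneg fun _ => (Real.exp_pos _).le)) (Real.exp_pos _).le

theorem backgroundLaw_eq (B : Fin F → Matrix (Fin d) (Fin d) ℂ) :
    backgroundLaw N B = (volume : Measure (Fin N → Fin F → Fin d → ℂ)).withDensity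
      fun z => ∏ n, ENNReal.ofReal (∏ f, gaussianDensity (B f) (z n f)) := by
  have hsig : ∀ f, SigmaFinite ((volume : Measure (Fin d → ℂ)).withDensity
      fun z => ENNReal.ofReal (gaussianDensity (B f) z)) := fun f =>
    SigmaFinite.withDensity_ofReal _
  have h1 : Measure.pi (fun f => (volume : Measure (Fin d → ℂ)).withDensity
      fun z => ENNReal.ofReal (gaussianDensity (B f) z))
      = (volume : Measure (Fin F → Fin d → ℂ)).withDensity
        fun z => ENNReal.ofReal (∏ f, gaussianDensity (B f) (z f)) := by
    rw [pi_withDensity _ fun f => (measurable_gaussianDensity (B f)).ennreal_ofReal]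
    simp only [ENNReal.ofReal_prod_of_nonneg fun f _ => gaussianDensity_nonneg (B f) _]
    rfl
  have hm : Measurable fun z : Fin F → Fin d → ℂ => ∏ f, gaussianDensity (B f) (z f) :=
    Finset.measurable_prod _ fun f _ =>
      (measurable_gaussianDensity (B f)).comp (measurable_pi_apply f)
  have hsig' : SigmaFinite ((volume : Measure (Fin F → Fin d → ℂ)).withDensity
        fun z => ENNReal.ofReal (∏ f, gaussianDensity (B f) (z f))) :=
    SigmaFinite.withDensity_ofReal _
  rw [backgroundLaw]
  simp only [h1]
  rw [pi_withDensity _ fun n => hm.ennreal_ofReal]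
  rfl

theorem demix_mulVec (θ : Filters F d) (x : Data N F d) (n : Fin N) (f : Fin F) :
    demix θ f *ᵥ x n f = Fin.cons (target θ x n f) (background θ x n f) := by
  ext i
  refine Fin.cases ?_ (fun i => ?_) i <;>
    simp [demix, target, background, Matrix.mulVec, dotProduct]

theorem target_background_mix {θ : Filters F d} (hθ : Nondegenerate θ)
    (y : (Fin N → Fin F → ℂ) × (Fin N → Fin F → Fin d → ℂ)) (n : Fin N) (f : Fin F) :
    target θ (mix θ y) n f = y.1 n f ∧ background θ (mix θ y) n f = y.2 n f := by
  have h := demix_mulVec θ (mix θ y) n f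
  rw [mix, Matrix.mulVec_mulVec, Matrix.mul_nonsing_inv _ (isUnit_iff_ne_zero.2 (hθ f)),
    Matrix.one_mulVec] at h
  exact ⟨(Fin.cons_injective2 h).1.symm, (Fin.cons_injective2 h).2.symm⟩

/-- The law of the mixture has the likelihood as its density. The density of the sources is written
as `g ∘ mix θ`, and the change of variables contributes the factors `|det W_f|²`. -/
theorem observedLaw_eq {G : Fin N → ℝ → ℝ} (hG : ∀ n, IsSuperGaussian (G n))
    (B : Fin F → Matrix (Fin d) (Fin d) ℂ) {θ : Filters F d} (hθ : Nondegenerate θ) :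
    observedLaw G B θ = (volume : Measure (Data N F d)).withDensity
      fun y => ENNReal.ofReal (likelihood G B y θ) := by
  have hms : ∀ n, Measurable (sourceDensity (G n) : (Fin F → ℂ) → ℝ) := fun n =>
    measurable_sourceDensity (hG n)
  have hmg : ∀ f, Measurable (gaussianDensity (B f)) := fun f => measurable_gaussianDensity (B f)
  have hm1 : Measurable fun s : Fin N → Fin F → ℂ =>
      ∏ n, ENNReal.ofReal (sourceDensity (G n) (s n)) := by fun_prop
  have hm2 : Measurable fun z : Fin N → Fin F → Fin d → ℂ =>
      ∏ n, ENNReal.ofReal (∏ f, gaussianDensity (B f) (z n f)) := by fun_prop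
  have hmt : Measurable fun (x : Data N F d) n f => target θ x n f := by
    refine Continuous.measurable (continuous_pi fun n => continuous_pi fun f => ?_)
    unfold target
    fun_prop
  have hmb : Measurable fun (x : Data N F d) n f => background θ x n f := by
    refine Continuous.measurable (continuous_pi fun n => continuous_pi fun f =>
      continuous_pi fun i => ?_)
    unfold background
    fun_prop
  set g : Data N F d → ENNReal := fun x =>
    (∏ n, ENNReal.ofReal (sourceDensity (G n) (target θ x n)))
      * ∏ n, ENNReal.ofReal (∏ f, gaussianDensity (B f) (background θ x n f)) with hg
  have hgm : Measurable g := (hm1.comp hmt).mul (hm2.comp hmb)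
  have hmix : mix θ = (fun (a : Data N F d) n f => (demix θ f)⁻¹ *ᵥ a n f)
      ∘ fun (y : (Fin N → Fin F → ℂ) × (Fin N → Fin F → Fin d → ℂ)) n f =>
        (Fin.cons (y.1 n f) (y.2 n f) : Fin (d + 1) → ℂ) := rfl
  have hdm : Measurable fun (a : Data N F d) n f => (demix θ f)⁻¹ *ᵥ a n f := by
    refine Continuous.measurable (continuous_pi fun n => continuous_pi fun f => ?_)
    exact Continuous.matrix_mulVec continuous_const (by fun_prop)
  have hmm : Measurable (mix (N := N) θ) := by
    rw [hmix]
    exact hdm.comp measurePreserving_cons.measurable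
  have hvol : ((volume : Measure (Fin N → Fin F → ℂ)).prod
      (volume : Measure (Fin N → Fin F → Fin d → ℂ))).map (mix θ)
      = volume.withDensity
          fun _ => ENNReal.ofReal (∏ _n : Fin N, ∏ f, ‖(demix θ f).det‖ ^ 2) := by
    rw [hmix, ← Measure.map_map hdm measurePreserving_cons.measurable, ← map_demix_volume hθ,
      ← (measurePreserving_cons (N := N) (F := F) (d := d)).map_eq]
    rfl
  have hsrc : (fun y : (Fin N → Fin F → ℂ) × (Fin N → Fin F → Fin d → ℂ) =>
      (∏ n, ENNReal.ofReal (sourceDensity (G n) (y.1 n)))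
        * ∏ n, ENNReal.ofReal (∏ f, gaussianDensity (B f) (y.2 n f))) = fun y => g (mix θ y) := by
    funext y
    have ht : ∀ n, target θ (mix θ y) n = y.1 n := fun n =>
      funext fun f => (target_background_mix hθ y n f).1
    have hb : ∀ n f, background θ (mix θ y) n f = y.2 n f := fun n f =>
      (target_background_mix hθ y n f).2
    simp only [hg, ht, hb]
  have hsf1 : SFinite (volume : Measure (Fin N → Fin F → ℂ)) := inferInstance
  have hsf2 : SigmaFinite (volume : Measure (Fin F → Fin d → ℂ)) := inferInstance
  have hsf3 : SFinite (volume : Measure (Fin N → Fin F → Fin d → ℂ)) :=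
    inferInstanceAs (SFinite (Measure.pi fun _ : Fin N => (volume : Measure (Fin F → Fin d → ℂ))))
  rw [observedLaw, sourceLaw_eq hG, backgroundLaw_eq, prod_withDensity hm1 hm2, hsrc,
    map_withDensity_comp _ hmm hgm, hvol, ← withDensity_mul _ measurable_const hgm]
  congr 1
  funext y
  have hp : ∀ n, 0 ≤ ∏ f, gaussianDensity (B f) (background θ y n f) := fun n =>
    Finset.prod_nonneg fun f _ => gaussianDensity_nonneg _ _
  have hd : ∀ _n : Fin N, 0 ≤ ∏ f, ‖(demix θ f).det‖ ^ 2 := fun _ =>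
    Finset.prod_nonneg fun f _ => sq_nonneg _
  simp only [hg, likelihood, Pi.mul_apply, Finset.prod_mul_distrib]
  rw [← ENNReal.ofReal_prod_of_nonneg fun n _ => sourceDensity_nonneg _ _,
    ← ENNReal.ofReal_prod_of_nonneg fun n _ => hp n,
    ← ENNReal.ofReal_mul (Finset.prod_nonneg fun n _ => sourceDensity_nonneg _ _),
    ← ENNReal.ofReal_mul (Finset.prod_nonneg fun n _ => hd n)]
  congr 1
  ring

end

/-! ### Global minimizers of the auxiliary function -/

section Minimizers

variable {N F d : ℕ} {G : Fin N → ℝ → ℝ} {B : Fin F → Matrix (Fin d) (Fin d) ℂ}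
  {x : Data N F d} {Q : Fin F → Matrix (Fin (d + 1)) (Fin (d + 1)) ℂ}

theorem Module.End.HasEigenvalue.exists_unit_eigenvector {m : ℕ} {A : Matrix (Fin m) (Fin m) ℂ}
    {l : ℂ} (hl : Module.End.HasEigenvalue (Matrix.toLin' A) l) :
    ∃ v, A *ᵥ v = l • v ∧ star v ⬝ᵥ v = 1 := by
  obtain ⟨v, hv⟩ := hl.exists_hasEigenvector
  have h1 : A *ᵥ v = l • v := by
    have := Module.End.mem_eigenspace_iff.1 hv.1
    rwa [Matrix.toLin'_apply] at this
  have h2 : 0 < ∑ i, ‖v i‖ ^ 2 := by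
    obtain ⟨i, hi⟩ := Function.ne_iff.1 hv.2
    exact Finset.sum_pos' (fun i _ => by positivity)
      ⟨i, Finset.mem_univ i, pow_pos (norm_pos_iff.2 hi) 2⟩
  refine ⟨(((Real.sqrt (∑ i, ‖v i‖ ^ 2))⁻¹ : ℝ) : ℂ) • v, ?_, ?_⟩
  · rw [Matrix.mulVec_smul, h1, smul_comm]
  · rw [star_smul, smul_dotProduct, dotProduct_smul, Matrix.dotProduct_star_self_eq_sum_sq,
      RCLike.star_def, Complex.conj_ofReal, smul_eq_mul, smul_eq_mul, ← Complex.ofReal_mul,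
      ← Complex.ofReal_mul, ← mul_assoc, ← mul_inv, Real.mul_self_sqrt h2.le,
      inv_mul_cancel₀ h2.ne', Complex.ofReal_one]

/-- The minimum of the auxiliary function at one frequency: it is attained at the filter computed
by the algorithm, and only at eigenvectors for the smallest eigenvalue. -/
theorem exists_isLeast_auxiliaryAt (hB : ∀ f, (B f).PosDef) (hQ : ∀ f, IsUnit (Q f).det)
    (hxQ : ∀ f, sampleCov x f = (Q f)ᴴ * Q f) {φ : Fin N → ℝ → ℝ} {r : Fin N → ℝ}
    (hφ : ∀ n, 0 < φ n (r n)) (f : Fin F) :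
    ∃ a : ℝ,
      (∀ p, (demixAt p).det ≠ 0 →
        a ≤ auxiliaryAt (weightedCov φ r x f) (sampleCov x f) (B f) p) ∧
      (∀ (l : ℝ) (v : Fin (d + 1) → ℂ),
        IsSmallestEigenvalue (weightedCov φ r (whiten Q x) f) l →
        weightedCov φ r (whiten Q x) f *ᵥ v = (l : ℂ) • v → star v ⬝ᵥ v = 1 →
        ∃ p, p 0 = (Q f)⁻¹ *ᵥ ((((Real.sqrt l)⁻¹ : ℝ) : ℂ) • v) ∧ (demixAt p).det ≠ 0 ∧
          auxiliaryAt (weightedCov φ r x f) (sampleCov x f) (B f) p = a) ∧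
      (∀ p, (demixAt p).det ≠ 0 →
        auxiliaryAt (weightedCov φ r x f) (sampleCov x f) (B f) p ≤ a →
        ∃ l : ℝ, IsSmallestEigenvalue (weightedCov φ r (whiten Q x) f) l ∧
          weightedCov φ r (whiten Q x) f *ᵥ (Q f *ᵥ p 0) = (l : ℂ) • (Q f *ᵥ p 0) ∧
          l * ∑ i, ‖(Q f *ᵥ p 0) i‖ ^ 2 = 1) := by
  have hpd := posDef_weightedCov_whiten (hQ f) (hxQ f) φ r hφ
  obtain ⟨S, hS, hBS⟩ := (hB f).inv.exists_eq_mul_conjTranspose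
  obtain ⟨l, hl⟩ := hpd.1.exists_isSmallestEigenvalue
  have hl0 := hpd.pos_of_isSmallestEigenvalue hl
  have hV := star_dotProduct_weightedCov_whiten (x := x) (hQ f) φ r
  refine ⟨auxiliaryFloor (Q f) l S, fun p hp => ?_, fun l' v hl' hv hv1 => ?_, fun p hp h => ?_⟩
  · exact auxiliaryFloor_le (hQ f).ne_zero hS hBS (hxQ f) hV hpd.1 hl hl0 hp
  · obtain rfl := hl'.unique hl
    exact exists_auxiliaryAt_eq_floor (hQ f).ne_zero hS hBS (hxQ f) hV hl0 hv hv1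
  · exact ⟨l, hl, eigenvector_of_auxiliaryAt_le (hQ f).ne_zero hS hBS (hxQ f) hV hpd.1 hl hl0 hp h⟩

/-- The filters found by the algorithm can be completed to global minimizers, frequency by
frequency. -/
theorem exists_isCompletion (hG : ∀ n, IsSuperGaussian (G n)) (hB : ∀ f, (B f).PosDef)
    (hQ : ∀ f, IsUnit (Q f).det) (hxQ : ∀ f, sampleCov x f = (Q f)ᴴ * Q f)
    {s : ℕ → Fin N → Fin F → ℂ} {u : ℕ → Fin F → Fin (d + 1) → ℂ}
    (hrun : IsFIVERun (fun n => weight (G n)) (whiten Q x) s u)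
    (hs : ∀ k n, WeightDefined (G n) (activity (s k n))) :
    ∃ θ : ℕ → Filters F d, IsCompletion G B x Q s u θ := by
  have h : ∀ k f, ∃ p : Fin (d + 1) → Fin (d + 1) → ℂ, p 0 = (Q f)⁻¹ *ᵥ u k f ∧
      (demixAt p).det ≠ 0 ∧ ∀ q, (demixAt q).det ≠ 0 →
        auxiliaryAt (weightedCov (fun n => weight (G n)) (fun n => activity (s k n)) x f)
          (sampleCov x f) (B f) p
        ≤ auxiliaryAt (weightedCov (fun n => weight (G n)) (fun n => activity (s k n)) x f)
          (sampleCov x f) (B f) q := fun k f => by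
    obtain ⟨a, h1, h2, -⟩ := exists_isLeast_auxiliaryAt (φ := fun n => weight (G n)) hB hQ hxQ
      (fun n => (hG n).weight_pos (hs k n)) f
    obtain ⟨l, v, hl, hv, hv1, hu⟩ := hrun.filter_step k f
    obtain ⟨p, hp0, hp, hpa⟩ := h2 l v hl hv hv1
    exact ⟨p, by rw [hp0, hu], hp, fun q hq => hpa.trans_le (h1 q hq)⟩
  choose θ h0 h1 h2 using h
  refine ⟨θ, fun k => ⟨h0 k, h1 k, fun η hη => ?_⟩⟩
  rw [auxiliary_eq, auxiliary_eq]
  gcongr with f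
  exact h2 k f _ (hη f)

/-- The target filters of a global minimizer of the auxiliary function are, in whitened coordinates,
smallest eigenvectors. The summands of the auxiliary function can be minimized independently, so a
minimizer of the sum minimizes each of them. -/
theorem eigenvector_of_minimizes_auxiliary (hG : ∀ n, IsSuperGaussian (G n))
    (hB : ∀ f, (B f).PosDef) (hQ : ∀ f, IsUnit (Q f).det)
    (hxQ : ∀ f, sampleCov x f = (Q f)ᴴ * Q f) {r : Fin N → ℝ}
    (hr : ∀ n, WeightDefined (G n) (r n)) {η : Filters F d} (hη : Nondegenerate η)
    (hmin : ∀ ζ, Nondegenerate ζ → auxiliary G B x r η ≤ auxiliary G B x r ζ) (f : Fin F) :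
    ∃ l : ℝ, IsSmallestEigenvalue (weightedCov (fun n => weight (G n)) r (whiten Q x) f) l ∧
      weightedCov (fun n => weight (G n)) r (whiten Q x) f *ᵥ (Q f *ᵥ η f 0)
        = (l : ℂ) • (Q f *ᵥ η f 0) ∧
      l * ∑ i, ‖(Q f *ᵥ η f 0) i‖ ^ 2 = 1 := by
  choose a h1 h2 h3 using exists_isLeast_auxiliaryAt (φ := fun n => weight (G n)) hB hQ hxQ
    (fun n => (hG n).weight_pos (hr n))
  have hp : ∀ f, ∃ p, (demixAt p).det ≠ 0 ∧
      auxiliaryAt (weightedCov (fun n => weight (G n)) r x f) (sampleCov x f) (B f) p = a f :=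
    fun f => by
      obtain ⟨l, hl⟩ :=
        (isHermitian_weightedCov (fun n => weight (G n)) r
          (whiten Q x) f).exists_isSmallestEigenvalue
      obtain ⟨v, hv, hv1⟩ := hl.1.exists_unit_eigenvector
      obtain ⟨p, -, hp⟩ := h2 f l v hl hv hv1
      exact ⟨p, hp⟩
  choose ζ hζ hζa using hp
  have h4 := hmin ζ hζ
  have hN : (0 : ℝ) < N := by exact_mod_cast frames_pos hQ hxQ f
  rw [auxiliary_eq, auxiliary_eq, add_le_add_iff_right, mul_le_mul_iff_right₀ hN] at h4
  simp only [hζa] at h4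
  refine h3 f (η f) (hη f) ?_
  by_contra! hlt
  exact absurd h4 (not_le.2 (Finset.sum_lt_sum (fun f _ => h1 f _ (hη f))
    ⟨f, Finset.mem_univ f, hlt⟩))

end Minimizers

/-! ### Continuity and differentiability -/

section Regularity

variable {N F d : ℕ} {G : Fin N → ℝ → ℝ} {B : Fin F → Matrix (Fin d) (Fin d) ℂ}
  {x : Data N F d}

theorem differentiable_det_demix (f : Fin F) :
    Differentiable ℝ fun θ : Filters F d => (demix θ f).det := by
  simp only [Matrix.det_apply, demix, Matrix.of_apply]
  fun_prop

theorem continuous_det_demix (f : Fin F) : Continuous fun θ : Filters F d => (demix θ f).det :=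
  (differentiable_det_demix f).continuous

theorem isOpen_nondegenerate : IsOpen {θ : Filters F d | Nondegenerate θ} := by
  simp only [Nondegenerate, Set.ofPred_forall]
  exact isOpen_iInter_of_finite fun f =>
    isOpen_compl_singleton.preimage (continuous_det_demix f)

theorem differentiable_activity_sq (n : Fin N) :
    Differentiable ℝ fun θ : Filters F d => activity (target θ x n) ^ 2 := by
  simp only [activity_sq, target, dotProduct, Pi.star_apply]
  refine Differentiable.fun_sum fun f _ => Differentiable.norm_sq ℝ ?_
  fun_prop

theorem continuous_activity_target (n : Fin N) :
    Continuous fun θ : Filters F d => activity (target θ x n) := by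
  refine continuous_activity.comp ?_
  unfold target
  fun_prop

theorem differentiable_trace_background (f : Fin F) (C : Matrix (Fin (d + 1)) (Fin (d + 1)) ℂ)
    (K : Matrix (Fin d) (Fin d) ℂ) :
    Differentiable ℝ fun θ : Filters F d =>
      (Matrix.trace ((backgroundFilter θ f)ᴴ * C * backgroundFilter θ f * K)).re := by
  have h : Differentiable ℝ fun θ : Filters F d =>
      Matrix.trace ((backgroundFilter θ f)ᴴ * C * backgroundFilter θ f * K) := by
    simp only [Matrix.trace, Matrix.diag_apply, Matrix.mul_apply, Matrix.conjTranspose_apply,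
      backgroundFilter, Matrix.of_apply]
    fun_prop
  exact Complex.reCLM.differentiable.comp h

theorem differentiableAt_log_det {θ : Filters F d} (hθ : Nondegenerate θ) (f : Fin F) :
    DifferentiableAt ℝ (fun θ : Filters F d => Real.log ‖(demix θ f).det‖) θ :=
  ((differentiable_det_demix f θ).norm ℝ (hθ f)).log (norm_ne_zero_iff.2 (hθ f))

/-- Where the activity vanishes, it enters `G` only through its square, which has a vanishing
derivative there. -/
theorem differentiableAt_comp_activity {g : ℝ → ℝ} (hg : IsSuperGaussian g) {n : Fin N}
    {η : Filters F d} (hη : WeightDefined g (activity (target η x n))) :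
    DifferentiableAt ℝ (fun θ : Filters F d => g (activity (target θ x n))) η := by
  have hsq := differentiable_activity_sq (F := F) (x := x) n η
  rcases hη with h | ⟨h, h0⟩
  · have h1 : DifferentiableAt ℝ (fun θ : Filters F d => activity (target θ x n)) η := by
      have h2 := hsq.sqrt (pow_pos h 2).ne'
      simpa only [Real.sqrt_sq (activity_nonneg _)] using h2
    exact ((hg.differentiable _ h).differentiableAt (Ioi_mem_nhds h)).comp η h1
  · have hmin : IsLocalMin (fun θ : Filters F d => activity (target θ x n) ^ 2) η :=
      Eventually.of_forall fun θ => by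
        change activity (target η x n) ^ 2 ≤ activity (target θ x n) ^ 2
        rw [h, zero_pow two_ne_zero]
        positivity
    have hd := hsq.hasFDerivAt
    rw [hmin.fderiv_eq_zero] at hd
    refine HasFDerivAt.differentiableAt (f' := 0) ?_
    rw [hasFDerivAt_iff_isLittleO] at hd ⊢
    refine Asymptotics.IsBigO.trans_isLittleO (Asymptotics.IsBigO.of_bound (weight g 0)
      (Eventually.of_forall fun θ => ?_)) hd
    have hpos := activity_nonneg (target θ x n)
    have h1 : g (activity (target θ x n))
        ≤ g 0 + weight g 0 * (activity (target θ x n) ^ 2 - 0 ^ 2) :=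
      hg.le_tangent (Or.inr ⟨rfl, h0⟩) hpos
    have h2 : g 0 ≤ g (activity (target θ x n)) :=
      hg.strictMono.monotoneOn (Set.mem_Ici.2 le_rfl) hpos hpos
    rw [zero_pow two_ne_zero, sub_zero] at h1
    simp only [h, zero_apply, sub_zero, Real.norm_eq_abs, zero_pow two_ne_zero, abs_sq]
    rw [abs_of_nonneg (by linarith)]
    linarith

theorem differentiableAt_auxiliary (r : Fin N → ℝ) {η : Filters F d} (hη : Nondegenerate η) :
    DifferentiableAt ℝ (auxiliary G B x r) η := by
  have h1 := differentiableAt_log_det hη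
  have h2 := fun n => differentiable_activity_sq (F := F) (x := x) n η
  have h3 := fun f => differentiable_trace_background f (sampleCov x f) ((B f)⁻¹) η
  unfold auxiliary
  simp only [quadratic_weightedCov]
  exact ((((DifferentiableAt.fun_sum fun f _ => h1 f).const_mul _).fun_add
    (DifferentiableAt.fun_sum fun n _ => (h2 n).const_mul _)).fun_add
    ((DifferentiableAt.fun_sum fun f _ => h3 f).const_mul _)).add_const _

theorem differentiableAt_negLogLik (hG : ∀ n, IsSuperGaussian (G n))
    (hint : ∀ n, Integrable (fun s : Fin F → ℂ => Real.exp (-G n (activity s))))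
    (hB : ∀ f, (B f).PosDef) {η : Filters F d} (hη : Admissible G x η) :
    DifferentiableAt ℝ (negLogLik G B x) η := by
  have h1 := differentiableAt_log_det hη.1
  have h2 := fun n => differentiableAt_comp_activity (hG n) (hη.2 n)
  have h3 := fun f => differentiable_trace_background f (sampleCov x f) ((B f)⁻¹) η
  have h : (negLogLik G B x) =ᶠ[𝓝 η] fun θ =>
      -2 * N * ∑ f, Real.log ‖(demix θ f).det‖ + ∑ n, G n (activity (target θ x n))
        + N * ∑ f, (Matrix.trace
            ((backgroundFilter θ f)ᴴ * sampleCov x f * backgroundFilter θ f * (B f)⁻¹)).re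
        + normalization G B := by
    filter_upwards [isOpen_nondegenerate.mem_nhds hη.1] with θ hθ
    exact negLogLik_eq hint hB x hθ
  refine DifferentiableAt.congr_of_eventuallyEq ?_ h
  exact ((((DifferentiableAt.fun_sum fun f _ => h1 f).const_mul _).fun_add
    (DifferentiableAt.fun_sum fun n _ => h2 n)).fun_add
    ((DifferentiableAt.fun_sum fun f _ => h3 f).const_mul _)).add_const _

/-- A global minimizer of its own auxiliary function is a stationary point. -/
theorem isStationaryPt_of_minimizes (hG : ∀ n, IsSuperGaussian (G n))
    (hint : ∀ n, Integrable (fun s : Fin F → ℂ => Real.exp (-G n (activity s))))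
    (hB : ∀ f, (B f).PosDef) {η : Filters F d} (hη : Admissible G x η)
    (hmin : ∀ ζ, Nondegenerate ζ → auxiliary G B x (fun n => activity (target η x n)) η
      ≤ auxiliary G B x (fun n => activity (target η x n)) ζ) :
    IsStationaryPt G B x η := by
  set A := auxiliary G B x (fun n => activity (target η x n)) with hA
  have hL := differentiableAt_negLogLik hG hint hB hη
  have hAd : DifferentiableAt ℝ A η := differentiableAt_auxiliary _ hη.1
  have hnhds := isOpen_nondegenerate.mem_nhds hη.1
  have h1 : IsLocalMin A η := by
    filter_upwards [hnhds] with θ hθ using hmin θ hθ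
  -- `A` touches the negative log-likelihood from above at `η`
  have h2 : IsLocalMin (fun θ => A θ - negLogLik G B x θ) η := by
    filter_upwards [hnhds] with θ hθ
    have h3 : negLogLik G B x η = A η := negLogLik_eq_auxiliary hint hB x hη.1
    have h4 : negLogLik G B x θ ≤ A θ := negLogLik_le_auxiliary hG hint hB x hη.2 hθ
    linarith
  have h3 := h2.hasFDerivAt_eq_zero (hAd.hasFDerivAt.sub hL.hasFDerivAt)
  rw [h1.fderiv_eq_zero, zero_sub, neg_eq_zero] at h3
  exact ⟨hη.1, h3 ▸ hL.hasFDerivAt⟩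

/-- The auxiliary function is jointly continuous in the magnitudes and the filters. -/
theorem tendsto_auxiliary (hG : ∀ n, IsSuperGaussian (G n)) {ι : Type*} {l : Filter ι}
    {r : ι → Fin N → ℝ} {ρ : Fin N → ℝ} {θ : ι → Filters F d} {η : Filters F d}
    (hr0 : ∀ i n, 0 ≤ r i n) (hr : ∀ n, Tendsto (fun i => r i n) l (𝓝 (ρ n)))
    (hρ : ∀ n, WeightDefined (G n) (ρ n)) (hθ : Tendsto θ l (𝓝 η)) (hη : Nondegenerate η) :
    Tendsto (fun i => auxiliary G B x (r i) (θ i)) l (𝓝 (auxiliary G B x ρ η)) := by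
  have hr' : ∀ n, Tendsto (fun i => r i n) l (𝓝[Set.Ici 0] (ρ n)) := fun n =>
    tendsto_nhdsWithin_iff.2 ⟨hr n, Eventually.of_forall fun i => hr0 i n⟩
  have hρ0 : ∀ n, 0 ≤ ρ n := fun n => by
    rcases hρ n with h | ⟨h, -⟩
    exacts [h.le, h.ge]
  have hw : ∀ n, Tendsto (fun i => weight (G n) (r i n)) l (𝓝 (weight (G n) (ρ n))) := fun n =>
    ((hG n).continuousWithinAt_weight (hρ n)).tendsto.comp (hr' n)
  have hg : ∀ n, Tendsto (fun i => G n (r i n)) l (𝓝 (G n (ρ n))) := fun n =>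
    ((hG n).continuous _ (hρ0 n)).tendsto.comp (hr' n)
  have h1 : ∀ f, Tendsto (fun i => Real.log ‖(demix (θ i) f).det‖) l
      (𝓝 (Real.log ‖(demix η f).det‖)) := fun f =>
    (differentiableAt_log_det hη f).continuousAt.tendsto.comp hθ
  have h2 : ∀ n, Tendsto (fun i => activity (target (θ i) x n) ^ 2) l
      (𝓝 (activity (target η x n) ^ 2)) := fun n =>
    ((differentiable_activity_sq n).continuous.tendsto η).comp hθ
  have h3 : ∀ f, Tendsto (fun i => (Matrix.trace ((backgroundFilter (θ i) f)ᴴ * sampleCov x f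
      * backgroundFilter (θ i) f * (B f)⁻¹)).re) l (𝓝 (Matrix.trace ((backgroundFilter η f)ᴴ
      * sampleCov x f * backgroundFilter η f * (B f)⁻¹)).re) := fun f =>
    ((differentiable_trace_background f _ _).continuous.tendsto η).comp hθ
  unfold auxiliary
  simp only [quadratic_weightedCov]
  exact (((tendsto_const_nhds.mul (tendsto_finsetSum _ fun f _ => h1 f)).add
    (tendsto_finsetSum _ fun n _ => (hw n).mul (h2 n))).add
    (tendsto_const_nhds.mul (tendsto_finsetSum _ fun f _ => h3 f))).add
    ((tendsto_finsetSum _ fun n _ => (hg n).sub ((hw n).mul ((hr n).pow 2))).add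
      tendsto_const_nhds)

theorem tendsto_negLogLik (hG : ∀ n, IsSuperGaussian (G n))
    (hint : ∀ n, Integrable (fun s : Fin F → ℂ => Real.exp (-G n (activity s))))
    (hB : ∀ f, (B f).PosDef) {ι : Type*} {l : Filter ι} {θ : ι → Filters F d} {η : Filters F d}
    (hθ : Tendsto θ l (𝓝 η)) (hη : Admissible G x η) :
    Tendsto (fun i => negLogLik G B x (θ i)) l (𝓝 (negLogLik G B x η)) :=
  (differentiableAt_negLogLik hG hint hB hη).continuousAt.tendsto.comp hθ

end Regularity

/-! ### Limits of majorize-minimize sequences -/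

/-- A majorize-minimize sequence: each term minimizes the auxiliary function that belongs to the
magnitudes of the preceding term. -/
structure IsMajMinSeq {N F d : ℕ} (G : Fin N → ℝ → ℝ) (B : Fin F → Matrix (Fin d) (Fin d) ℂ)
    (x : Data N F d) (θ : ℕ → Filters F d) : Prop where
  admissible : ∀ k, Admissible G x (θ k)
  minimizes : ∀ k ζ, Nondegenerate ζ →
    auxiliary G B x (fun n => activity (target (θ k) x n)) (θ (k + 1))
      ≤ auxiliary G B x (fun n => activity (target (θ k) x n)) ζ

section Limits

variable {N F d : ℕ} {G : Fin N → ℝ → ℝ} {B : Fin F → Matrix (Fin d) (Fin d) ℂ}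
  {x : Data N F d} {Q : Fin F → Matrix (Fin (d + 1)) (Fin (d + 1)) ℂ}

/-- The estimate computed from `u k` is the target output of `θ k`, so that the magnitudes used in
iteration `k + 1` are those of `θ k`. -/
theorem IsCompletion.isMajMinSeq (hQ : ∀ f, IsUnit (Q f).det) {s : ℕ → Fin N → Fin F → ℂ}
    {u : ℕ → Fin F → Fin (d + 1) → ℂ} {θ : ℕ → Filters F d} {φ : Fin N → ℝ → ℝ}
    (hrun : IsFIVERun φ (whiten Q x) s u)
    (hs : ∀ k n, WeightDefined (G n) (activity (s k n))) (hθ : IsCompletion G B x Q s u θ) :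
    IsMajMinSeq G B x θ := by
  have h : ∀ k n, s (k + 1) n = target (θ k) x n := fun k n => by
    funext f
    have hu : u k f = Q f *ᵥ θ k f 0 := by
      rw [(hθ k).1 f, Matrix.mulVec_mulVec, Matrix.mul_nonsing_inv _ (hQ f), Matrix.one_mulVec]
    rw [hrun.estimate_step, hu, star_mulVec_dotProduct_whiten (hQ f), target]
  refine ⟨fun k => ⟨(hθ k).2.1, fun n => h k n ▸ hs (k + 1) n⟩, fun k ζ hζ => ?_⟩
  simp only [← h]
  exact (hθ (k + 1)).2.2 ζ hζ

theorem IsMajMinSeq.antitone (hG : ∀ n, IsSuperGaussian (G n))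
    (hint : ∀ n, Integrable (fun s : Fin F → ℂ => Real.exp (-G n (activity s))))
    (hB : ∀ f, (B f).PosDef) {θ : ℕ → Filters F d} (hθ : IsMajMinSeq G B x θ) :
    Antitone fun k => negLogLik G B x (θ k) :=
  antitone_nat_of_succ_le fun k =>
    (negLogLik_le_auxiliary hG hint hB x (hθ.admissible k).2 (hθ.admissible (k + 1)).1).trans
      ((hθ.minimizes k _ (hθ.admissible k).1).trans
        (negLogLik_eq_auxiliary hint hB x (hθ.admissible k).1).ge)

theorem re_trace_background_nonneg (hB : ∀ f, (B f).PosDef)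
    (hxQ : ∀ f, sampleCov x f = (Q f)ᴴ * Q f) (θ : Filters F d) (f : Fin F) :
    0 ≤ (Matrix.trace
      ((backgroundFilter θ f)ᴴ * sampleCov x f * backgroundFilter θ f * (B f)⁻¹)).re := by
  obtain ⟨S, -, hBS⟩ := (hB f).inv.exists_eq_mul_conjTranspose
  rw [re_trace_background (hxQ f) hBS]
  positivity

/-- On a sublevel set of the negative log-likelihood the determinants stay away from zero. -/
theorem exists_le_prod_norm_det (hG : ∀ n, IsSuperGaussian (G n))
    (hint : ∀ n, Integrable (fun s : Fin F → ℂ => Real.exp (-G n (activity s))))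
    (hB : ∀ f, (B f).PosDef) (hQ : ∀ f, IsUnit (Q f).det)
    (hxQ : ∀ f, sampleCov x f = (Q f)ᴴ * Q f) (C : ℝ) :
    ∃ δ > 0, ∀ θ : Filters F d, Nondegenerate θ → negLogLik G B x θ ≤ C →
      δ ≤ ∏ f, ‖(demix θ f).det‖ := by
  -- the lower bound below divides by `N`, which may vanish only if there are no frequencies
  rcases Nat.eq_zero_or_pos F with hF | hF
  · subst hF
    exact ⟨1, one_pos, fun θ _ _ => by simp⟩
  have hN : (0 : ℝ) < N := by exact_mod_cast frames_pos hQ hxQ ⟨0, hF⟩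
  refine ⟨Real.exp ((∑ n, G n 0 + normalization G B - C) / (2 * N)), Real.exp_pos _,
    fun θ hθ hL => ?_⟩
  have hpos : 0 < ∏ f, ‖(demix θ f).det‖ := Finset.prod_pos fun f _ => norm_pos_iff.2 (hθ f)
  rw [← Real.le_log_iff_exp_le hpos, Real.log_prod fun f _ => norm_ne_zero_iff.2 (hθ f),
    div_le_iff₀ (by positivity)]
  rw [negLogLik_eq hint hB x hθ] at hL
  have h1 : ∑ n, G n 0 ≤ ∑ n, G n (activity (target θ x n)) := Finset.sum_le_sum fun n _ =>
    (hG n).strictMono.monotoneOn (Set.mem_Ici.2 le_rfl) (activity_nonneg _) (activity_nonneg _)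
  have h2 : 0 ≤ N * ∑ f, (Matrix.trace
      ((backgroundFilter θ f)ᴴ * sampleCov x f * backgroundFilter θ f * (B f)⁻¹)).re :=
    mul_nonneg hN.le (Finset.sum_nonneg fun f _ => re_trace_background_nonneg hB hxQ θ f)
  linarith

theorem nondegenerate_of_prod_norm_det_pos {θ : Filters F d} {δ : ℝ} (hδ : 0 < δ)
    (h : δ ≤ ∏ f, ‖(demix θ f).det‖) : Nondegenerate θ := fun f h0 => by
  have : ∏ f, ‖(demix θ f).det‖ = 0 :=
    Finset.prod_eq_zero (Finset.mem_univ f) (by rw [h0, norm_zero])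
  linarith

theorem continuous_prod_norm_det :
    Continuous fun θ : Filters F d => ∏ f, ‖(demix θ f).det‖ :=
  continuous_finsetProd _ fun f _ => (continuous_det_demix f).norm

variable {θ : ℕ → Filters F d} {l : Filter ℕ} [l.NeBot] {η : Filters F d}

theorem IsMajMinSeq.nondegenerate_of_tendsto (hG : ∀ n, IsSuperGaussian (G n))
    (hint : ∀ n, Integrable (fun s : Fin F → ℂ => Real.exp (-G n (activity s))))
    (hB : ∀ f, (B f).PosDef) (hQ : ∀ f, IsUnit (Q f).det)
    (hxQ : ∀ f, sampleCov x f = (Q f)ᴴ * Q f) (hθ : IsMajMinSeq G B x θ)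
    (hη : Tendsto θ l (𝓝 η)) : Nondegenerate η := by
  obtain ⟨δ, hδ, h⟩ := exists_le_prod_norm_det (Q := Q) hG hint hB hQ hxQ
    (negLogLik G B x (θ 0))
  refine nondegenerate_of_prod_norm_det_pos hδ
    (ge_of_tendsto ((continuous_prod_norm_det.tendsto η).comp hη)
      (Eventually.of_forall fun k => ?_))
  exact h _ (hθ.admissible k).1 (hθ.antitone hG hint hB (Nat.zero_le k))

theorem IsMajMinSeq.negLogLik_le (hG : ∀ n, IsSuperGaussian (G n))
    (hint : ∀ n, Integrable (fun s : Fin F → ℂ => Real.exp (-G n (activity s))))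
    (hB : ∀ f, (B f).PosDef) (hθ : IsMajMinSeq G B x θ) (hl : l ≤ atTop)
    (hη : Tendsto θ l (𝓝 η)) (had : Admissible G x η) (k : ℕ) :
    negLogLik G B x η ≤ negLogLik G B x (θ k) := by
  refine le_of_tendsto (tendsto_negLogLik hG hint hB hη had) ?_
  filter_upwards [hl (eventually_ge_atTop k)] with j hj
  exact hθ.antitone hG hint hB hj

/-- A limit point of a majorize-minimize sequence minimizes its own auxiliary function, because
the values of the objective along the sequence stay above its value at the limit point. -/
theorem IsMajMinSeq.minimizes_of_tendsto (hG : ∀ n, IsSuperGaussian (G n))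
    (hint : ∀ n, Integrable (fun s : Fin F → ℂ => Real.exp (-G n (activity s))))
    (hB : ∀ f, (B f).PosDef) (hθ : IsMajMinSeq G B x θ) (hl : l ≤ atTop)
    (hη : Tendsto θ l (𝓝 η)) (had : Admissible G x η) {ζ : Filters F d} (hζ : Nondegenerate ζ) :
    auxiliary G B x (fun n => activity (target η x n)) η
      ≤ auxiliary G B x (fun n => activity (target η x n)) ζ := by
  rw [← negLogLik_eq_auxiliary hint hB x had.1]
  have h := tendsto_auxiliary (B := B) (x := x) hG (l := l)
    (r := fun k n => activity (target (θ k) x n)) (fun k n => activity_nonneg _)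
    (fun n => ((continuous_activity_target n).tendsto η).comp hη) had.2
    (tendsto_const_nhds (x := ζ)) hζ
  refine ge_of_tendsto h (Eventually.of_forall fun k => ?_)
  exact (hθ.negLogLik_le hG hint hB hl hη had (k + 1)).trans
    ((negLogLik_le_auxiliary hG hint hB x (hθ.admissible k).2 (hθ.admissible (k + 1)).1).trans
      (hθ.minimizes k ζ hζ))

theorem IsMajMinSeq.isStationaryPt_of_tendsto (hG : ∀ n, IsSuperGaussian (G n))
    (hint : ∀ n, Integrable (fun s : Fin F → ℂ => Real.exp (-G n (activity s))))
    (hB : ∀ f, (B f).PosDef) (hθ : IsMajMinSeq G B x θ) (hl : l ≤ atTop)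
    (hη : Tendsto θ l (𝓝 η)) (had : Admissible G x η) : IsStationaryPt G B x η :=
  isStationaryPt_of_minimizes hG hint hB had fun _ hζ =>
    hθ.minimizes_of_tendsto hG hint hB hl hη had hζ

/-- A limit of the successors `θ (k + 1)` minimizes the auxiliary function of the limit of the
`θ k`. -/
theorem IsMajMinSeq.successor_minimizes_of_tendsto (hG : ∀ n, IsSuperGaussian (G n))
    (hθ : IsMajMinSeq G B x θ) (hη : Tendsto θ l (𝓝 η)) (had : Admissible G x η)
    {η' : Filters F d} (hη' : Tendsto (fun k => θ (k + 1)) l (𝓝 η')) (hnd : Nondegenerate η')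
    {ζ : Filters F d} (hζ : Nondegenerate ζ) :
    auxiliary G B x (fun n => activity (target η x n)) η'
      ≤ auxiliary G B x (fun n => activity (target η x n)) ζ := by
  have h := fun {ω : ℕ → Filters F d} {ξ : Filters F d} => tendsto_auxiliary (B := B) (x := x) hG
    (l := l) (r := fun k n => activity (target (θ k) x n)) (θ := ω) (η := ξ)
    (fun k n => activity_nonneg _)
    (fun n => ((continuous_activity_target n).tendsto η).comp hη) had.2
  exact le_of_tendsto_of_tendsto (h hη' hnd) (h (tendsto_const_nhds (x := ζ)) hζ)
    (Eventually.of_forall fun k => hθ.minimizes k ζ hζ)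

/-- A confined run converges, in value and in distance, to the stationary points. -/
theorem IsMajMinSeq.tendsto_stationary (hG : ∀ n, IsSuperGaussian (G n))
    (hint : ∀ n, Integrable (fun s : Fin F → ℂ => Real.exp (-G n (activity s))))
    (hB : ∀ f, (B f).PosDef) (hθ : IsMajMinSeq G B x θ) (hK : IsConfined G x θ) :
    ∃ c : ℝ, Tendsto (fun k => negLogLik G B x (θ k)) atTop (𝓝 c) ∧
      ∀ ε > 0, ∀ᶠ k in atTop, ∃ η : Filters F d,
        IsStationaryPt G B x η ∧ negLogLik G B x η = c ∧ dist (θ k) η < ε := by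
  obtain ⟨K, hKc, hKa, hθK⟩ := hK
  have hlim : ∀ g : Ultrafilter ℕ, ∃ η ∈ K, Tendsto θ g (𝓝 η) := fun g => by
    obtain ⟨η, hη, hle⟩ := hKc.ultrafilter_le_nhds (g.map θ)
      (tendsto_principal.2 (Eventually.of_forall hθK) : Tendsto θ g (𝓟 K))
    exact ⟨η, hη, hle⟩
  have hc : ∃ c, Tendsto (fun k => negLogLik G B x (θ k)) atTop (𝓝 c) := by
    obtain ⟨η, hη, hle⟩ := hlim (Ultrafilter.of atTop)
    refine ⟨_, tendsto_atTop_ciInf (hθ.antitone hG hint hB) ⟨negLogLik G B x η, ?_⟩⟩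
    rintro _ ⟨k, rfl⟩
    exact hθ.negLogLik_le hG hint hB (Ultrafilter.of_le atTop) hle (hKa η hη) k
  obtain ⟨c, hc⟩ := hc
  refine ⟨c, hc, fun ε hε => mem_iff_ultrafilter.2 fun g hg => ?_⟩
  obtain ⟨η, hη, hle⟩ := hlim g
  have h1 := hθ.isStationaryPt_of_tendsto hG hint hB hg hle (hKa η hη)
  have h2 : negLogLik G B x η = c :=
    tendsto_nhds_unique (tendsto_negLogLik hG hint hB hle (hKa η hη)) (hc.mono_left hg)
  filter_upwards [hle (Metric.ball_mem_nhds η hε)] with k hk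
  exact ⟨η, h1, h2, hk⟩

end Limits

/-! ### Coercivity -/

section Coercivity

theorem exists_le_sub_log {g : ℝ → ℝ} (hg : IsSuperGaussian g) {c : ℝ} (hc : 0 ≤ c)
    (h : Tendsto (fun r => g r - c * Real.log r) atTop atTop) :
    ∃ m, ∀ r, 0 < r → m ≤ g r - c * Real.log r := by
  obtain ⟨R, hR⟩ := eventually_atTop.1 (h.eventually_ge_atTop 0)
  refine ⟨min 0 (g 0 - c * Real.log R), fun r hr => ?_⟩
  rcases le_total R r with h1 | h1
  · exact (min_le_left _ _).trans (hR r h1)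
  · refine (min_le_right _ _).trans ?_
    have h2 := hg.strictMono.monotoneOn (Set.mem_Ici.2 le_rfl) (Set.mem_Ici.2 hr.le) hr.le
    have h3 := mul_le_mul_of_nonneg_left (Real.log_le_log hr h1) hc
    linarith

theorem exists_bound_of_sub_log {g : ℝ → ℝ} {c : ℝ}
    (h : Tendsto (fun r => g r - c * Real.log r) atTop atTop) (C : ℝ) :
    ∃ ρ, 0 ≤ ρ ∧ ∀ r, g r - c * Real.log r ≤ C → r ≤ ρ := by
  obtain ⟨R, hR⟩ := eventually_atTop.1 (h.eventually_gt_atTop C)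
  refine ⟨max R 0, le_max_right _ _, fun r hr => ?_⟩
  by_contra! hlt
  exact absurd hr (not_le.2 (hR r ((le_max_left _ _).trans hlt.le)))

variable {N F d : ℕ} {G : Fin N → ℝ → ℝ} {B : Fin F → Matrix (Fin d) (Fin d) ℂ}
  {x : Data N F d} {Q : Fin F → Matrix (Fin (d + 1)) (Fin (d + 1)) ℂ}

/-- The logarithm of the determinant is dominated by the logarithm of the length of the target
filter and half of the quadratic term of the background filters. -/
theorem exists_le_neg_log_det (hB : ∀ f, (B f).PosDef) (hQ : ∀ f, IsUnit (Q f).det)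
    (hxQ : ∀ f, sampleCov x f = (Q f)ᴴ * Q f) (f : Fin F) :
    ∃ c : ℝ, ∀ θ : Filters F d, Nondegenerate θ →
      0 < ∑ i, ‖(Q f *ᵥ θ f 0) i‖ ^ 2 ∧
      c - Real.log (∑ i, ‖(Q f *ᵥ θ f 0) i‖ ^ 2)
        - (Matrix.trace ((backgroundFilter θ f)ᴴ * sampleCov x f * backgroundFilter θ f
            * (B f)⁻¹)).re / 2
        ≤ -2 * Real.log ‖(demix θ f).det‖ := by
  obtain ⟨S, hS, hBS⟩ := (hB f).inv.exists_eq_mul_conjTranspose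
  -- the scale `1 / √2` leaves half of the quadratic term of the background filters over
  set S' : Matrix (Fin d) (Fin d) ℂ := (((Real.sqrt 2)⁻¹ : ℝ) : ℂ) • S with hS'
  have hs2 : (((Real.sqrt 2)⁻¹ : ℝ) : ℂ) ≠ 0 := by
    exact_mod_cast inv_ne_zero (Real.sqrt_pos.2 two_pos).ne'
  have hdet : S'.det ≠ 0 := by
    rw [hS', Matrix.det_smul]
    exact mul_ne_zero (pow_ne_zero _ hs2) hS
  refine ⟨Real.log (‖(Q f).det‖ ^ 2) + Real.log (‖S'.det‖ ^ 2) + d, fun θ hθ => ?_⟩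
  have hτ : 0 < ∑ i, ‖(Q f *ᵥ θ f 0) i‖ ^ 2 := by
    have h0 : Q f *ᵥ θ f 0 ≠ 0 := fun h => by
      have h1 : θ f 0 = 0 := Matrix.eq_zero_of_mulVec_eq_zero (hQ f).ne_zero h
      exact hθ f (Matrix.det_eq_zero_of_row_eq_zero 0 fun j => by simp [demix, h1])
    obtain ⟨i, hi⟩ := Function.ne_iff.1 h0
    exact Finset.sum_pos' (fun i _ => by positivity)
      ⟨i, Finset.mem_univ i, pow_pos (norm_pos_iff.2 hi) 2⟩
  -- the scale `l = 1 / ‖Q w‖²` normalizes the target filter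
  have h1 := log_norm_det_demixAt_le (p := θ f) (hQ f).ne_zero (inv_pos.2 hτ) hdet (hθ f)
  have h2 : ∑ j, ∑ i, ‖(Q f * backgroundAt (θ f) * S') i j‖ ^ 2
      = (Matrix.trace ((backgroundFilter θ f)ᴴ * sampleCov x f * backgroundFilter θ f
            * (B f)⁻¹)).re / 2 := by
    rw [re_trace_background (hxQ f) hBS, Finset.sum_div]
    refine Finset.sum_congr rfl fun j _ => ?_
    rw [Finset.sum_div]
    refine Finset.sum_congr rfl fun i _ => ?_
    rw [hS', Matrix.mul_smul, Matrix.smul_apply, norm_smul, mul_pow, Complex.norm_real,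
      Real.norm_eq_abs, sq_abs, inv_pow, Real.sq_sqrt two_pos.le, div_eq_inv_mul]
    rfl
  rw [h2, inv_mul_cancel₀ hτ.ne', Real.log_inv] at h1
  refine ⟨hτ, ?_⟩
  rw [demix_eq_demixAt]
  linarith

/-- The negative log-likelihood is coercive if the `G n` grow faster than `2 N F log`. The largest
magnitude `R` controls all the target filters, so that all the logarithms are dominated by the
single term `G n R`. -/
theorem exists_bound_of_negLogLik_le (hG : ∀ n, IsSuperGaussian (G n))
    (hint : ∀ n, Integrable (fun s : Fin F → ℂ => Real.exp (-G n (activity s))))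
    (hB : ∀ f, (B f).PosDef) (hQ : ∀ f, IsUnit (Q f).det)
    (hxQ : ∀ f, sampleCov x f = (Q f)ᴴ * Q f)
    (hgrow : ∀ n, Tendsto (fun r => G n r - 2 * N * F * Real.log r) atTop atTop) (C : ℝ) :
    ∃ M : ℝ, ∀ θ : Filters F d, Nondegenerate θ → negLogLik G B x θ ≤ C → ∀ f,
      ∑ i, ‖(Q f *ᵥ θ f 0) i‖ ^ 2
        + (Matrix.trace ((backgroundFilter θ f)ᴴ * sampleCov x f * backgroundFilter θ f
            * (B f)⁻¹)).re ≤ M := by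
  rcases Nat.eq_zero_or_pos F with hF | hF
  · subst hF
    exact ⟨0, fun θ _ _ f => f.elim0⟩
  have hN0 : 0 < N := frames_pos hQ hxQ ⟨0, hF⟩
  have hN : (0 : ℝ) < N := by exact_mod_cast hN0
  have hne : (Finset.univ : Finset (Fin N)).Nonempty := ⟨⟨0, hN0⟩, Finset.mem_univ _⟩
  choose c hc using exists_le_neg_log_det hB hQ hxQ
  choose m hm using fun n => exists_le_sub_log (hG n) (by positivity) (hgrow n)
  set C' : ℝ := C - normalization G B - N * ∑ f, c f - ∑ n, G n 0 + ∑ n, |G n 0| with hC'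
  choose ρ hρ0 hρ using fun n => exists_bound_of_sub_log (hgrow n) C'
  set R₀ : ℝ := ∑ n, ρ n with hR₀
  refine ⟨R₀ ^ 2 + 2 / N * (C' + ∑ n, |m n|), fun θ hθ hL f => ?_⟩
  set τ : Fin F → ℝ := fun f => ∑ i, ‖(Q f *ᵥ θ f 0) i‖ ^ 2 with hτ
  set T : Fin F → ℝ := fun f => (Matrix.trace ((backgroundFilter θ f)ᴴ * sampleCov x f
    * backgroundFilter θ f * (B f)⁻¹)).re with hT
  have hT0 : ∀ f, 0 ≤ T f := fun f => re_trace_background_nonneg hB hxQ θ f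
  obtain ⟨n₀, -, hn₀⟩ := Finset.exists_max_image Finset.univ
    (fun n => activity (target θ x n)) hne
  set R : ℝ := activity (target θ x n₀) with hR
  have hR0 : 0 ≤ R := activity_nonneg _
  -- by whitening, `‖Q w‖²` is the mean over the frames of `|wᴴ x|²`
  have hτR : ∀ f, τ f ≤ R ^ 2 := fun f => by
    have h1 : ∀ n, ‖star (θ f 0) ⬝ᵥ x n f‖ ^ 2 ≤ R ^ 2 := fun n => by
      calc ‖star (θ f 0) ⬝ᵥ x n f‖ ^ 2 = ‖target θ x n f‖ ^ 2 := rfl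
        _ ≤ ∑ f, ‖target θ x n f‖ ^ 2 :=
          Finset.single_le_sum (f := fun f => ‖target θ x n f‖ ^ 2)
            (fun f _ => by positivity) (Finset.mem_univ f)
        _ = activity (target θ x n) ^ 2 := (activity_sq _).symm
        _ ≤ R ^ 2 := pow_le_pow_left₀ (activity_nonneg _) (hn₀ n (Finset.mem_univ n)) 2
    calc τ f = (1 / N : ℝ) * ∑ n, ‖star (θ f 0) ⬝ᵥ x n f‖ ^ 2 := sum_sq_mulVec_eq (hxQ f) _
      _ ≤ (1 / N : ℝ) * ∑ _n : Fin N, R ^ 2 :=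
        mul_le_mul_of_nonneg_left (Finset.sum_le_sum fun n _ => h1 n) (by positivity)
      _ = R ^ 2 := by
        rw [Finset.sum_const, Finset.card_univ, Fintype.card_fin, nsmul_eq_mul]
        field_simp
  have hτ0 : ∀ f, 0 < τ f := fun f => (hc f θ hθ).1
  have hRpos : 0 < R := by
    rcases hR0.lt_or_eq with h | h
    · exact h
    · have := (hτ0 f).trans_le (hτR f)
      rw [← h] at this
      norm_num at this
  have hlogτ : ∀ f, Real.log (τ f) ≤ 2 * Real.log R := fun f => by
    have := Real.log_le_log (hτ0 f) (hτR f)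
    rwa [Real.log_pow, Nat.cast_ofNat] at this
  have hsumG : (∑ n, G n 0) + (G n₀ R - G n₀ 0) ≤ ∑ n, G n (activity (target θ x n)) := by
    have h1 : ∀ n, 0 ≤ G n (activity (target θ x n)) - G n 0 := fun n => sub_nonneg.2
      ((hG n).strictMono.monotoneOn (Set.mem_Ici.2 le_rfl) (activity_nonneg _) (activity_nonneg _))
    have h2 := Finset.single_le_sum (fun n _ => h1 n) (Finset.mem_univ n₀)
    rw [Finset.sum_sub_distrib] at h2
    linarith
  have hG0 : G n₀ 0 ≤ ∑ n, |G n 0| := (le_abs_self _).trans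
    (Finset.single_le_sum (f := fun n => |G n 0|) (fun n _ => abs_nonneg _) (Finset.mem_univ n₀))
  have hdet : N * ∑ f, (c f - 2 * Real.log R - T f / 2)
      ≤ -2 * N * ∑ f, Real.log ‖(demix θ f).det‖ := by
    have h1 : ∑ f, (c f - 2 * Real.log R - T f / 2)
        ≤ ∑ f, -2 * Real.log ‖(demix θ f).det‖ := Finset.sum_le_sum fun f _ => by
      have := (hc f θ hθ).2
      have := hlogτ f
      linarith
    rw [← Finset.mul_sum] at h1
    have h2 := mul_le_mul_of_nonneg_left h1 hN.le
    linarith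
  rw [negLogLik_eq hint hB x hθ] at hL
  simp only [Finset.sum_sub_distrib, Finset.sum_const, Finset.card_univ, Fintype.card_fin,
    nsmul_eq_mul, ← Finset.sum_div] at hdet
  have hkey : G n₀ R - 2 * N * F * Real.log R + N * (∑ f, T f) / 2 ≤ C' := by
    rw [hC']
    linarith
  have hNT : 0 ≤ N * (∑ f, T f) / 2 := by
    have := Finset.sum_nonneg fun f (_ : f ∈ Finset.univ) => hT0 f
    positivity
  have hRle : R ≤ R₀ := (hρ n₀ R (by linarith)).trans
    (Finset.single_le_sum (fun n _ => hρ0 n) (Finset.mem_univ n₀))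
  have hmle : -∑ n, |m n| ≤ m n₀ := by
    have h1 := Finset.single_le_sum (f := fun n => |m n|) (fun n _ => abs_nonneg _)
      (Finset.mem_univ n₀)
    have h2 := neg_abs_le (m n₀)
    linarith
  have hTle : ∑ f, T f ≤ 2 / N * (C' + ∑ n, |m n|) := by
    have h1 := hm n₀ R hRpos
    rw [div_mul_eq_mul_div, le_div_iff₀ hN]
    linarith
  have hTf : T f ≤ ∑ f, T f := Finset.single_le_sum (fun f _ => hT0 f) (Finset.mem_univ f)
  have hτf : τ f ≤ R₀ ^ 2 := (hτR f).trans (pow_le_pow_left₀ hR0 hRle 2)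
  exact add_le_add hτf (hTf.trans hTle)

/-- If the `G n` grow fast enough and the weights are finite at zero, then a sublevel set of the
negative log-likelihood lies in a compact set of admissible parameters: the whitened filters are
bounded there, and the determinants are bounded away from zero. -/
theorem isConfined_of_growth (hG : ∀ n, IsSuperGaussian (G n))
    (hint : ∀ n, Integrable (fun s : Fin F → ℂ => Real.exp (-G n (activity s))))
    (hB : ∀ f, (B f).PosDef) (hQ : ∀ f, IsUnit (Q f).det)
    (hxQ : ∀ f, sampleCov x f = (Q f)ᴴ * Q f) (h0 : ∀ n, FiniteAtZero (G n))
    (hgrow : ∀ n, Tendsto (fun r => G n r - 2 * N * F * Real.log r) atTop atTop)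
    {θ : ℕ → Filters F d} (hθ : IsMajMinSeq G B x θ) : IsConfined G x θ := by
  obtain ⟨δ, hδ, hdet⟩ := exists_le_prod_norm_det (Q := Q) hG hint hB hQ hxQ
    (negLogLik G B x (θ 0))
  obtain ⟨M, hM⟩ := exists_bound_of_negLogLik_le hG hint hB hQ hxQ hgrow (negLogLik G B x (θ 0))
  choose S hS hBS using fun f => (hB f).inv.exists_eq_mul_conjTranspose
  have hE : ∀ f, IsUnit (blockScale 1 (S f)).det := fun f => by
    rw [det_blockScale]
    simpa using hS f
  -- the inverse of the passage to whitened coordinates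
  set Ψ : (Fin F → Fin (d + 1) → Fin (d + 1) → ℂ) → Filters F d :=
    fun a f i j => ((Q f)⁻¹ * Matrix.of (a f) * (blockScale 1 (S f))⁻¹) j i with hΨ
  have hΨc : Continuous Ψ := by
    refine continuous_pi fun f => continuous_pi fun i => continuous_pi fun j => ?_
    simp only [hΨ, Matrix.mul_apply, Matrix.of_apply]
    fun_prop
  have hΨθ : ∀ η : Filters F d, 
      Ψ (fun f i j => whitenedFilters (Q f) 1 (S f) (η f) i j) = η := fun η => by
    funext f i j
    have h : (Q f)⁻¹ * whitenedFilters (Q f) 1 (S f) (η f) * (blockScale 1 (S f))⁻¹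
        = (demixAt (η f))ᴴ := by
      rw [whitenedFilters, Matrix.mul_assoc (Q f),
        Matrix.nonsing_inv_mul_cancel_left _ _ (hQ f),
        Matrix.mul_nonsing_inv_cancel_right _ _ (hE f)]
    change ((Q f)⁻¹ * whitenedFilters (Q f) 1 (S f) (η f) * (blockScale 1 (S f))⁻¹) j i = _
    rw [h]
    simp [demixAt]
  refine ⟨Ψ '' Metric.closedBall 0 (Real.sqrt M) ∩ {η | δ ≤ ∏ f, ‖(demix η f).det‖},
    ((isCompact_closedBall _ _).image hΨc).inter_right
      (isClosed_le continuous_const continuous_prod_norm_det), fun η hη => ⟨?_, fun n => ?_⟩,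
    fun k => ⟨⟨fun f i j => whitenedFilters (Q f) 1 (S f) (θ k f) i j, ?_, hΨθ _⟩, ?_⟩⟩
  · exact nondegenerate_of_prod_norm_det_pos hδ hη.2
  · rcases (activity_nonneg (target η x n)).lt_or_eq with h | h
    exacts [Or.inl h, Or.inr ⟨h.symm, h0 n⟩]
  · have hL := hθ.antitone hG hint hB (Nat.zero_le k)
    rw [mem_closedBall_zero_iff, pi_norm_le_iff_of_nonneg (Real.sqrt_nonneg _)]
    intro f
    rw [pi_norm_le_iff_of_nonneg (Real.sqrt_nonneg _)]
    intro i
    rw [pi_norm_le_iff_of_nonneg (Real.sqrt_nonneg _)]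
    intro j
    refine Real.le_sqrt_of_sq_le ?_
    have h1 := hM (θ k) (hθ.admissible k).1 hL f
    rw [re_trace_background (hxQ f) (hBS f)] at h1
    have h2 := sum_sq_whitenedFilters (Q f) 1 (S f) (θ k f) zero_le_one
    rw [one_mul] at h2
    have h3 := Finset.single_le_sum
      (f := fun i => ‖whitenedFilters (Q f) 1 (S f) (θ k f) i j‖ ^ 2)
      (fun i _ => by positivity) (Finset.mem_univ i)
    have h4 := Finset.single_le_sum
      (f := fun j => ∑ i, ‖whitenedFilters (Q f) 1 (S f) (θ k f) i j‖ ^ 2)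
      (fun j _ => by positivity) (Finset.mem_univ j)
    exact (h3.trans h4).trans (h2.trans_le h1)
  · exact hdet _ (hθ.admissible k).1 (hθ.antitone hG hint hB (Nat.zero_le k))

end Coercivity

/-! ### Convergence up to phases -/

/-- The squared Euclidean distance of `w` and `v` up to a phase, that is, the minimum of
`‖c w - v‖²` over `‖c‖ = 1`. -/
def phaseDist {m : ℕ} (v w : Fin m → ℂ) : ℝ :=
  ∑ i, ‖w i‖ ^ 2 + ∑ i, ‖v i‖ ^ 2 - 2 * ‖star v ⬝ᵥ w‖

section PhaseDist

variable {m : ℕ}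

theorem exists_phase (v w : Fin m → ℂ) :
    ∃ c : ℂ, ‖c‖ = 1 ∧ ∑ i, ‖c * w i - v i‖ ^ 2 = phaseDist v w := by
  obtain ⟨c, hc, h⟩ := RCLike.exists_norm_eq_mul_self (star v ⬝ᵥ w)
  refine ⟨c, hc, ?_⟩
  have h1 : ∀ i, ‖c * w i - v i‖ ^ 2
      = ‖w i‖ ^ 2 + ‖v i‖ ^ 2 - 2 * (c * (star (v i) * w i)).re := fun i => by
    rw [← Complex.normSq_eq_norm_sq, Complex.normSq_sub, Complex.normSq_eq_norm_sq,
      Complex.normSq_eq_norm_sq, norm_mul, hc, one_mul, RCLike.star_def]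
    congr 3
    ring
  have h2 : ∑ i, (c * (star (v i) * w i)).re = ‖star v ⬝ᵥ w‖ := by
    rw [← Complex.re_sum, ← Finset.mul_sum]
    exact (congrArg Complex.re h.symm).trans (Complex.ofReal_re _)
  simp only [h1, Finset.sum_sub_distrib, Finset.sum_add_distrib, ← Finset.mul_sum, h2, phaseDist]

theorem phaseDist_nonneg (v w : Fin m → ℂ) : 0 ≤ phaseDist v w := by
  obtain ⟨c, -, h⟩ := exists_phase v w
  rw [← h]
  positivity

theorem phaseDist_smul (v w : Fin m → ℂ) {c : ℂ} (hc : ‖c‖ = 1) :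
    phaseDist v (c • w) = phaseDist v w := by
  simp only [phaseDist, Pi.smul_apply, dotProduct_smul, norm_smul, hc, one_mul]

theorem phaseDist_self (v : Fin m → ℂ) : phaseDist v v = 0 := by
  rw [phaseDist, Matrix.dotProduct_star_self_eq_sum_sq, Complex.norm_real, Real.norm_eq_abs,
    abs_of_nonneg (by positivity)]
  ring

end PhaseDist

/-- A nonnegative sequence with vanishing increments which comes close to `0` infinitely often
tends to `0`, if it has no cluster points in an interval `(0, δ)`. -/
theorem tendsto_zero_of_cluster_gap {D : ℕ → ℝ} (h0 : ∀ k, 0 ≤ D k)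
    (hstep : Tendsto (fun k => D (k + 1) - D k) atTop (𝓝 0))
    (hfreq : ∀ ε > 0, ∃ᶠ k in atTop, D k < ε) {δ : ℝ} (hδ : 0 < δ)
    (hgap : ∀ (g : Ultrafilter ℕ) (y : ℝ), (g : Filter ℕ) ≤ atTop → Tendsto D g (𝓝 y) →
      y < δ → y = 0) :
    Tendsto D atTop (𝓝 0) := by
  refine Metric.tendsto_atTop.2 fun ε' hε' => ?_
  obtain ⟨ε, hε, hε1, hε2⟩ : ∃ ε, 0 < ε ∧ ε < δ ∧ ε < ε' :=
    ⟨min δ ε' / 2, by positivity, by linarith [min_le_left δ ε', lt_min hδ hε'],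
      by linarith [min_le_right δ ε', lt_min hδ hε']⟩
  -- eventually `D` avoids `[ε / 2, ε]` and moves by less than `ε / 2`, so once below it stays below
  have h1 : ∀ᶠ k in atTop, D k ∉ Set.Icc (ε / 2) ε := by
    refine mem_iff_ultrafilter.2 fun g hg => ?_
    by_contra hne
    have hgI : ∀ᶠ k in (g : Filter ℕ), D k ∈ Set.Icc (ε / 2) ε := by
      filter_upwards [Ultrafilter.compl_mem_iff_notMem.2 hne] with k hk using not_not.1 hk
    obtain ⟨y, hy, hle⟩ := isCompact_Icc.ultrafilter_le_nhds (g.map D)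
      (tendsto_principal.2 hgI : Tendsto D g (𝓟 (Set.Icc (ε / 2) ε)))
    have := hgap g y hg hle (hy.2.trans_lt hε1)
    linarith [hy.1]
  have h2 : ∀ᶠ k in atTop, D (k + 1) - D k < ε / 2 :=
    hstep.eventually_lt_const (half_pos hε)
  obtain ⟨K, hK⟩ := eventually_atTop.1 (h1.and h2)
  obtain ⟨k₀, hk₀, hD⟩ := (frequently_atTop.1 (hfreq (ε / 2) (half_pos hε))) K
  refine ⟨k₀, fun k hk => ?_⟩
  have h3 : D k < ε / 2 := by
    induction k, hk using Nat.le_induction with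
    | base => exact hD
    | succ k hk ih =>
      have h4 := (hK k (hk₀.trans hk)).2
      have h5 := (hK (k + 1) ((hk₀.trans hk).trans (Nat.le_succ k))).1
      by_contra! h6
      exact h5 ⟨h6, by linarith⟩
  rw [Real.dist_0_eq_abs, abs_of_nonneg (h0 k)]
  linarith

section Phases

variable {N F d : ℕ} {G : Fin N → ℝ → ℝ} {B : Fin F → Matrix (Fin d) (Fin d) ℂ}
  {x : Data N F d} {Q : Fin F → Matrix (Fin (d + 1)) (Fin (d + 1)) ℂ}

/-- Multiplication of the target filters by the phases `c f`. -/
def rephase (c : Fin F → ℂ) (θ : Filters F d) : Filters F d :=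
  fun f i j => (if i = 0 then c f else 1) * θ f i j

theorem rephase_zero (c : Fin F → ℂ) (θ : Filters F d) (f : Fin F) :
    rephase c θ f 0 = c f • θ f 0 := by
  funext j
  simp [rephase]

theorem norm_det_demix_rephase {c : Fin F → ℂ} (hc : ∀ f, ‖c f‖ = 1) (θ : Filters F d)
    (f : Fin F) : ‖(demix (rephase c θ) f).det‖ = ‖(demix θ f).det‖ := by
  have h : demix (rephase c θ) f
      = Matrix.diagonal (fun i : Fin (d + 1) => if i = 0 then star (c f) else 1) * demix θ f := by
    ext i j
    rw [Matrix.diagonal_mul]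
    by_cases hi : i = 0 <;> simp [demix, rephase, hi]
  have hn : ∀ i : Fin (d + 1), ‖(if i = 0 then star (c f) else 1 : ℂ)‖ = 1 := fun i => by
    split_ifs <;> simp [hc]
  rw [h, Matrix.det_mul, Matrix.det_diagonal, norm_mul, norm_prod]
  simp only [hn, Finset.prod_const_one, one_mul]

theorem activity_target_rephase {c : Fin F → ℂ} (hc : ∀ f, ‖c f‖ = 1) (θ : Filters F d)
    (n : Fin N) : activity (target (rephase c θ) x n) = activity (target θ x n) := by
  simp only [activity, target, rephase_zero, star_smul, smul_dotProduct, norm_smul, norm_star, hc,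
    one_mul]

theorem negLogLik_rephase {c : Fin F → ℂ} (hc : ∀ f, ‖c f‖ = 1) (θ : Filters F d) :
    negLogLik G B x (rephase c θ) = negLogLik G B x θ := by
  have hb : ∀ n f, background (rephase c θ) x n f = background θ x n f := fun n f => by
    funext i
    have : rephase c θ f i.succ = θ f i.succ := by
      funext j
      simp [rephase]
    simp only [background, this]
  simp only [negLogLik, likelihood, sourceDensity, norm_det_demix_rephase hc,
    activity_target_rephase hc, hb]

theorem Admissible.rephase {c : Fin F → ℂ} (hc : ∀ f, ‖c f‖ = 1) {η : Filters F d}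
    (hη : Admissible G x η) : Admissible G x (rephase c η) := by
  refine ⟨fun f => ?_, fun n => ?_⟩
  · rw [← norm_ne_zero_iff, norm_det_demix_rephase hc]
    exact norm_ne_zero_iff.2 (hη.1 f)
  · rw [activity_target_rephase hc]
    exact hη.2 n

/-- The negative log-likelihood is invariant under phases, so its stationary points are, too. -/
theorem IsStationaryPt.rephase {c : Fin F → ℂ} (hc : ∀ f, ‖c f‖ = 1) {η : Filters F d}
    (hη : IsStationaryPt G B x η) : IsStationaryPt G B x (rephase c η) := by
  have hc' : ∀ f, ‖(c f)⁻¹‖ = 1 := fun f => by rw [norm_inv, hc, inv_one]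
  have hinv : _root_.rephase (fun f => (c f)⁻¹) (_root_.rephase c η) = η := by
    funext f i j
    have hcf : c f ≠ 0 := norm_ne_zero_iff.1 (by rw [hc]; exact one_ne_zero)
    by_cases hi : i = 0 <;> simp [_root_.rephase, hi, hcf]
  have hd : DifferentiableAt ℝ (_root_.rephase (d := d) fun f => (c f)⁻¹)
      (_root_.rephase c η) := by
    unfold _root_.rephase
    fun_prop
  refine ⟨fun f => ?_, ?_⟩
  · rw [← norm_ne_zero_iff, norm_det_demix_rephase hc]
    exact norm_ne_zero_iff.2 (hη.1 f)
  · have h1 : HasFDerivAt (negLogLik G B x) (0 : Filters F d →L[ℝ] ℝ)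
        (_root_.rephase (fun f => (c f)⁻¹) (_root_.rephase c η)) := by
      rw [hinv]
      exact hη.2
    have h2 := h1.comp _ hd.hasFDerivAt
    rw [ContinuousLinearMap.zero_comp] at h2
    refine h2.congr_of_eventuallyEq (Eventually.of_forall fun θ => ?_)
    exact (negLogLik_rephase hc' θ).symm

/-- If the smallest eigenvalues are simple, the target filters of the global minimizers of the
auxiliary function are unique up to phases. -/
theorem exists_phase_of_minimizes (hG : ∀ n, IsSuperGaussian (G n)) (hB : ∀ f, (B f).PosDef)
    (hQ : ∀ f, IsUnit (Q f).det) (hxQ : ∀ f, sampleCov x f = (Q f)ᴴ * Q f) {r : Fin N → ℝ}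
    (hr : ∀ n, WeightDefined (G n) (r n)) {f : Fin F}
    (hsimple : ∀ l : ℝ,
      IsSmallestEigenvalue (weightedCov (fun n => weight (G n)) r (whiten Q x) f) l →
      Module.finrank ℂ (Module.End.eigenspace (Matrix.toLin'
        (weightedCov (fun n => weight (G n)) r (whiten Q x) f)) (l : ℂ)) = 1)
    {η η' : Filters F d} (hη : Nondegenerate η) (hη' : Nondegenerate η')
    (hmin : ∀ ζ, Nondegenerate ζ → auxiliary G B x r η ≤ auxiliary G B x r ζ)
    (hmin' : ∀ ζ, Nondegenerate ζ → auxiliary G B x r η' ≤ auxiliary G B x r ζ) :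
    ∃ c : ℂ, ‖c‖ = 1 ∧ η' f 0 = c • η f 0 := by
  obtain ⟨l, hl, hv, hn⟩ := eigenvector_of_minimizes_auxiliary hG hB hQ hxQ hr hη hmin f
  obtain ⟨l', hl', hv', hn'⟩ := eigenvector_of_minimizes_auxiliary hG hB hQ hxQ hr hη' hmin' f
  obtain rfl := hl'.unique hl
  have hmem : ∀ {y}, weightedCov (fun n => weight (G n)) r (whiten Q x) f *ᵥ y = (l' : ℂ) • y →
      y ∈ Module.End.eigenspace (Matrix.toLin'
        (weightedCov (fun n => weight (G n)) r (whiten Q x) f)) (l' : ℂ) := fun {y} hy => by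
    rw [Module.End.mem_eigenspace_iff, Matrix.toLin'_apply, hy]
  have hne : Q f *ᵥ η f 0 ≠ 0 := fun h => by
    rw [h] at hn
    simp at hn
  obtain ⟨c, hc⟩ := (finrank_eq_one_iff_of_nonzero'
    (⟨Q f *ᵥ η f 0, hmem hv⟩ : Module.End.eigenspace _ _)
    (fun h => hne (congrArg Subtype.val h))).1 (hsimple l' hl) ⟨Q f *ᵥ η' f 0, hmem hv'⟩
  have hc' : c • (Q f *ᵥ η f 0) = Q f *ᵥ η' f 0 := congrArg Subtype.val hc
  refine ⟨c, ?_, ?_⟩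
  · rw [← hc'] at hn'
    simp only [Pi.smul_apply, norm_smul, mul_pow, ← Finset.mul_sum] at hn'
    rw [mul_left_comm, hn, mul_one] at hn'
    exact (pow_eq_one_iff_of_nonneg (norm_nonneg c) two_ne_zero).1 hn'
  · have h1 : Q f *ᵥ (η' f 0 - c • η f 0) = 0 := by
      rw [Matrix.mulVec_sub, Matrix.mulVec_smul, hc', sub_self]
    exact sub_eq_zero.1 (Matrix.eq_zero_of_mulVec_eq_zero (hQ f).ne_zero h1)

/-- Convergence up to phases. The distance up to phases to a limit point has vanishing increments,
since the limits of consecutive terms minimize the same auxiliary function, and it has no small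
positive cluster points, since the limit points are isolated up to phases. -/
theorem IsMajMinSeq.tendsto_up_to_phases (hG : ∀ n, IsSuperGaussian (G n))
    (hint : ∀ n, Integrable (fun s : Fin F → ℂ => Real.exp (-G n (activity s))))
    (hB : ∀ f, (B f).PosDef) (hQ : ∀ f, IsUnit (Q f).det)
    (hxQ : ∀ f, sampleCov x f = (Q f)ᴴ * Q f) {θ : ℕ → Filters F d}
    (hθ : IsMajMinSeq G B x θ) (hK : IsConfined G x θ)
    (hiso : ∀ η : Filters F d, Admissible G x η → IsStationaryPt G B x η →
      ∃ ε > 0, ∀ η' : Filters F d, Admissible G x η' → IsStationaryPt G B x η' →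
        (∀ f, dist (η' f 0) (η f 0) < ε) → ∀ f, ∃ c : ℂ, ‖c‖ = 1 ∧ η' f 0 = c • η f 0)
    (hsimple : ∀ η : Filters F d, Admissible G x η → IsStationaryPt G B x η →
      ∀ (f : Fin F) (l : ℝ),
        IsSmallestEigenvalue (weightedCov (fun n => weight (G n))
          (fun n => activity (target η x n)) (whiten Q x) f) l →
        Module.finrank ℂ (Module.End.eigenspace (Matrix.toLin'
          (weightedCov (fun n => weight (G n))
            (fun n => activity (target η x n)) (whiten Q x) f)) (l : ℂ)) = 1) :
    ∃ η : Filters F d, IsStationaryPt G B x η ∧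
      ∃ c : ℕ → Fin F → ℂ, (∀ k f, ‖c k f‖ = 1) ∧
        ∀ f, Tendsto (fun k => c k f • θ k f 0) atTop (𝓝 (η f 0)) := by
  obtain ⟨K, hKc, hKa, hθK⟩ := hK
  have hlim : ∀ (g : Ultrafilter ℕ) (m : ℕ), ∃ η ∈ K, Tendsto (fun k => θ (k + m)) g (𝓝 η) :=
    fun g m => by
      obtain ⟨η, hη, hle⟩ := hKc.ultrafilter_le_nhds (g.map fun k => θ (k + m))
        (tendsto_principal.2 (Eventually.of_forall fun k => hθK (k + m)) :
          Tendsto (fun k => θ (k + m)) g (𝓟 K))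
      exact ⟨η, hη, hle⟩
  obtain ⟨η, hηK, hη⟩ := hlim (Ultrafilter.of atTop) 0
  have hηa := hKa η hηK
  have hstat : ∀ {g : Ultrafilter ℕ} {ζ : Filters F d}, (g : Filter ℕ) ≤ atTop → ζ ∈ K →
      Tendsto θ g (𝓝 ζ) → IsStationaryPt G B x ζ := fun hg hζ h =>
    hθ.isStationaryPt_of_tendsto hG hint hB hg h (hKa _ hζ)
  have hηs : IsStationaryPt G B x η := hstat (Ultrafilter.of_le atTop) hηK hη
  set Φ : Filters F d → ℝ := fun ζ => ∑ f, phaseDist (η f 0) (ζ f 0) with hΦ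
  have hΦc : Continuous Φ := by
    simp only [hΦ, phaseDist, dotProduct]
    fun_prop
  have hΦη : Φ η = 0 := by simp only [hΦ, phaseDist_self, Finset.sum_const_zero]
  have hΦphase : ∀ {ζ ζ' : Filters F d}, (∀ f, ∃ c : ℂ, ‖c‖ = 1 ∧ ζ' f 0 = c • ζ f 0) →
      Φ ζ' = Φ ζ := fun {ζ ζ'} h => Finset.sum_congr rfl fun f _ => by
    obtain ⟨c, hc, hcf⟩ := h f
    rw [hcf, phaseDist_smul _ _ hc]
  have hle : ∀ (ζ : Filters F d) f, phaseDist (η f 0) (ζ f 0) ≤ Φ ζ := fun ζ f =>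
    Finset.single_le_sum (f := fun f => phaseDist (η f 0) (ζ f 0))
      (fun f _ => phaseDist_nonneg _ _) (Finset.mem_univ f)
  have hstep : Tendsto (fun k => Φ (θ (k + 1)) - Φ (θ k)) atTop (𝓝 0) := by
    refine (tendsto_iff_ultrafilter _ _ _).2 fun g hg => ?_
    obtain ⟨ζ, hζ, h0⟩ := hlim g 0
    obtain ⟨ζ', hζ', h1⟩ := hlim g 1
    have hζs := hstat hg hζ h0
    -- both limits minimize the auxiliary function of `ζ`
    have heq : Φ ζ' = Φ ζ := hΦphase fun f =>
      exists_phase_of_minimizes hG hB hQ hxQ (hKa ζ hζ).2 (hsimple ζ (hKa ζ hζ) hζs f)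
        (hKa ζ hζ).1 (hKa ζ' hζ').1
        (fun ω hω => hθ.minimizes_of_tendsto hG hint hB hg h0 (hKa ζ hζ) hω)
        (fun ω hω => hθ.successor_minimizes_of_tendsto hG h0 (hKa ζ hζ) h1 (hKa ζ' hζ').1 hω)
    have h2 := ((hΦc.tendsto ζ').comp h1).sub ((hΦc.tendsto ζ).comp h0)
    rw [heq, sub_self] at h2
    exact h2
  have hfreq : ∀ ε > 0, ∃ᶠ k in atTop, Φ (θ k) < ε := fun ε hε => by
    have h1 := (hΦc.tendsto η).comp hη
    rw [hΦη] at h1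
    exact (h1.eventually_lt_const hε).frequently.filter_mono (Ultrafilter.of_le atTop)
  obtain ⟨ε, hε, hεiso⟩ := hiso η hηa hηs
  have hgap : ∀ (g : Ultrafilter ℕ) (y : ℝ), (g : Filter ℕ) ≤ atTop →
      Tendsto (fun k => Φ (θ k)) g (𝓝 y) → y < ε ^ 2 → y = 0 := fun g y hg hy hyε => by
    obtain ⟨ζ, hζ, h0⟩ := hlim g 0
    obtain rfl : Φ ζ = y := tendsto_nhds_unique ((hΦc.tendsto ζ).comp h0) hy
    choose c hc hcd using fun f => exists_phase (η f 0) (ζ f 0)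
    -- isolation applies after aligning the phases of `ζ` with those of `η`
    have h1 := hεiso (rephase c ζ) ((hKa ζ hζ).rephase hc) ((hstat hg hζ h0).rephase hc)
      fun f => by
        rw [rephase_zero, dist_pi_lt_iff hε]
        intro i
        rw [dist_eq_norm]
        refine lt_of_pow_lt_pow_left₀ 2 hε.le (lt_of_le_of_lt ?_ hyε)
        refine le_trans ?_ ((hcd f).trans_le (hle ζ f))
        exact Finset.single_le_sum (f := fun i => ‖c f * ζ f 0 i - η f 0 i‖ ^ 2)
          (fun i _ => by positivity) (Finset.mem_univ i)
    rw [← hΦη, ← hΦphase h1]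
    exact (hΦphase fun f => ⟨c f, hc f, rephase_zero c ζ f⟩).symm
  have hlim0 := tendsto_zero_of_cluster_gap
    (fun k => Finset.sum_nonneg fun f _ => phaseDist_nonneg (η f 0) (θ k f 0)) hstep hfreq
    (pow_pos hε 2) hgap
  choose c hc hcd using fun k f => exists_phase (η f 0) (θ k f 0)
  refine ⟨η, hηs, c, hc, fun f => tendsto_pi_nhds.2 fun i => ?_⟩
  have hsq : Tendsto (fun k => ‖c k f * θ k f 0 i - η f 0 i‖ ^ 2) atTop (𝓝 0) :=
    squeeze_zero (fun k => by positivity) (fun k =>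
      (Finset.single_le_sum (f := fun i => ‖c k f * θ k f 0 i - η f 0 i‖ ^ 2)
        (fun i _ => by positivity) (Finset.mem_univ i)).trans
        ((hcd k f).trans_le (hle (θ k) f))) hlim0
  have hnorm := hsq.sqrt
  simp only [Real.sqrt_sq (norm_nonneg _), Real.sqrt_zero] at hnorm
  exact tendsto_iff_norm_sub_tendsto_zero.2 hnorm

end Phases

end

theorem theorem1 {N F d : ℕ}
    (G : Fin N → ℝ → ℝ) (hG : ∀ n, IsSuperGaussian (G n))
    (hint : ∀ n, Integrable (fun s : Fin F → ℂ => Real.exp (-G n (activity s))))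
    (B : Fin F → Matrix (Fin d) (Fin d) ℂ) (hB : ∀ f, (B f).PosDef)
    (x : Data N F d)
    (Q : Fin F → Matrix (Fin (d + 1)) (Fin (d + 1)) ℂ) (hQ : ∀ f, IsUnit (Q f).det)
    (hxQ : ∀ f, sampleCov x f = (Q f)ᴴ * Q f)
    (s : ℕ → Fin N → Fin F → ℂ) (u : ℕ → Fin F → Fin (d + 1) → ℂ)
    (hrun : IsFIVERun (fun n => weight (G n)) (whiten Q x) s u)
    (hs : ∀ k n, WeightDefined (G n) (activity (s k n))) :
    -- `negLogLik` is the negative log-likelihood of the model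
    (∀ θ : Filters F d, Nondegenerate θ →
      observedLaw G B θ
        = (volume : Measure (Data N F d)).withDensity
            fun y => ENNReal.ofReal (likelihood G B y θ)) ∧
    -- the auxiliary function majorizes it, and touches it where the magnitudes agree
    (∀ r : Fin N → ℝ, (∀ n, WeightDefined (G n) (r n)) →
      ∀ θ : Filters F d, Nondegenerate θ →
        negLogLik G B x θ ≤ auxiliary G B x r θ ∧
        ((∀ n, r n = activity (target θ x n)) → negLogLik G B x θ = auxiliary G B x r θ)) ∧
    -- every iteration minimizes the auxiliary function globally
    (∃ θ : ℕ → Filters F d, IsCompletion G B x Q s u θ) ∧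
    ∀ θ : ℕ → Filters F d, IsCompletion G B x Q s u θ →
      -- descent
      Antitone (fun k => negLogLik G B x (θ k)) ∧
      -- every limit point at which the weights are defined is a stationary point
      (∀ η : Filters F d, MapClusterPt η atTop θ →
        (∀ n, WeightDefined (G n) (activity (target η x n))) → IsStationaryPt G B x η) ∧
      -- a confined run converges, in value and in distance, to the stationary points
      (IsConfined G x θ →
        ∃ c : ℝ, Tendsto (fun k => negLogLik G B x (θ k)) atTop (𝓝 c) ∧
          ∀ ε > 0, ∀ᶠ k in atTop, ∃ η : Filters F d,
            IsStationaryPt G B x η ∧ negLogLik G B x η = c ∧ dist (θ k) η < ε) ∧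
      -- the run is confined if the weights are finite at zero and the `G n` grow fast enough
      ((∀ n, FiniteAtZero (G n)) →
        (∀ n, Tendsto (fun r => G n r - 2 * N * F * Real.log r) atTop atTop) →
        IsConfined G x θ) ∧
      -- a confined run converges, up to phases, to a single stationary point, if the stationary
      -- target filters are isolated up to phases and the smallest eigenvalues there are simple
      (IsConfined G x θ →
        (∀ η : Filters F d, Admissible G x η → IsStationaryPt G B x η →
          ∃ ε > 0, ∀ η' : Filters F d, Admissible G x η' → IsStationaryPt G B x η' →
            (∀ f, dist (η' f 0) (η f 0) < ε) →
            ∀ f, ∃ c : ℂ, ‖c‖ = 1 ∧ η' f 0 = c • η f 0) →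
        (∀ η : Filters F d, Admissible G x η → IsStationaryPt G B x η →
          ∀ (f : Fin F) (l : ℝ),
            IsSmallestEigenvalue (weightedCov (fun n => weight (G n))
              (fun n => activity (target η x n)) (whiten Q x) f) l →
            Module.finrank ℂ (Module.End.eigenspace (Matrix.toLin'
              (weightedCov (fun n => weight (G n))
                (fun n => activity (target η x n)) (whiten Q x) f)) (l : ℂ)) = 1) →
        ∃ η : Filters F d, IsStationaryPt G B x η ∧
          ∃ c : ℕ → Fin F → ℂ, (∀ k f, ‖c k f‖ = 1) ∧
            ∀ f, Tendsto (fun k => c k f • θ k f 0) atTop (𝓝 (η f 0))) := by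
  have hmm := fun (θ : ℕ → Filters F d) (hθ : IsCompletion G B x Q s u θ) =>
    hθ.isMajMinSeq hQ hrun hs
  refine ⟨fun θ hθ => observedLaw_eq hG B hθ, fun r hr θ hθ =>
      ⟨negLogLik_le_auxiliary hG hint hB x hr hθ, fun h => ?_⟩,
    exists_isCompletion hG hB hQ hxQ hrun hs, fun θ hθ =>
      ⟨(hmm θ hθ).antitone hG hint hB, fun η hη hw => ?_,
        (hmm θ hθ).tendsto_stationary hG hint hB,
        fun h0 hgrow => isConfined_of_growth hG hint hB hQ hxQ h0 hgrow (hmm θ hθ),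
        (hmm θ hθ).tendsto_up_to_phases hG hint hB hQ hxQ⟩⟩
  · obtain rfl : r = fun n => activity (target θ x n) := funext h
    exact negLogLik_eq_auxiliary hint hB x hθ
  · obtain ⟨g, hg, hlim⟩ := mapClusterPt_iff_ultrafilter.1 hη
    exact (hmm θ hθ).isStationaryPt_of_tendsto hG hint hB hg hlim
      ⟨(hmm θ hθ).nondegenerate_of_tendsto hG hint hB hQ hxQ hlim, hw⟩
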